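/- Let $\mathcal W:[0,1]^2\to[0,1]$ be a graphon, i.e. a symmetric measurable function, and let $T$ be the Fredholm integral operator on $L^2[0,1]$ with kernel $\mathcal W$, $Tf(x)=\int_0^1\mathcal W(x,y)f(y)\,dy$. For each $N$ let $\mathcal G_N$ be a random simple graph on $N$ nodes drawn from $\mathcal W$ as follows: $N$ independent samples are drawn uniformly from $[0,1]$ and put in increasing order, $\mu_1\le\dots\le\mu_N$; given the samples, nodes $i<j$ are joined independently with probability $\mathcal W(\mu_i,\mu_j)$. All $\mathcal G_N$ live on one probability space; nothing is assumed about their joint distribution for different $N$. Let $\mathbf A_N$ be the adjacency matrix of $\mathcal G_N$ and $\mathbf S_N=\frac1N\mathbf A_N$. Divide $[0,1]$ into the strips $I_i=[\frac{i-1}{N},\frac iN)$, $1\le i\le N$. For $\mathbf x\in\mathbb R^N$ let $\phi(\mathbf x)=\sum_{i=1}^N[\mathbf x]_i\mathbf 1_{I_i}$, and let $T_e$ be the Fredholm integral operator whose kernel is the empirical graphon $\mathcal W_e=\sum_{i,j=1}^N[\mathbf A_N]_{i,j}\mathbf 1_{I_i\times I_j}$. For $K\ge0$ and real coefficients $h_0,h_1,\dots,h_K$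 put $$\mathbf H=h_0\mathbf I+\sum_{k=1}^Kh_k\mathbf S_N^k,\qquad \mathcal H_e=h_0I+\sum_{k=1}^Kh_kT_e^k,\qquad \mathcal H=h_0I+\sum_{k=1}^Kh_kT^k .$$ Then $\phi(\mathbf H\mathbf x)=\mathcal H_e\,\phi(\mathbf x)$ for every $N$, every $K$ and $h_0,\dots,h_K$, and every $\mathbf x\in\mathbb R^N$. Moreover, with probability $1$, the following holds for all $K$ and all $h_0,\dots,h_K$: 1. if $f:[0,1]\to\mathbb R$ is continuous and, for all $N$ and $i$, the entry $[\mathbf x_N]_i$ of $\mathbf x_N\in\mathbb R^N$ is either the mean $N\int_{I_i}f$ or a value of $f$ at some point of $[\frac{i-1}{N},\frac iN]$, then $$\|\phi(\mathbf H\mathbf x_N)-\mathcal Hf\|_{L^2[0,1]}\to0\quad\text{as }N\to\infty;$$ 2. the same convergence holds for every $f\in L^2[0,1]$ and every sequence $\mathbf x_N\in\mathbb R^N$ with $\|\phi(\mathbf x_N)-f\|_{L^2[0,1]}\to0$. -/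

import Mathlib

open MeasureTheory Filter Topology
open scoped unitInterval

namespace GraphonFilter

noncomputable section

/-- A graphon: a symmetric measurable function `[0,1]² → [0,1]`. -/
structure Graphon where
  /-- the underlying kernel -/
  ker : I → I → ℝ
  measurable_ker : Measurable (Function.uncurry ker)
  symm : ∀ x y, ker x y = ker y x
  mem_Icc : ∀ x y, ker x y ∈ Set.Icc (0 : ℝ) 1

/-- The Fredholm integral operator `(T f)(x) = ∫₀¹ w(x,y) f(y) dy` with kernel `w`. -/
def fredholm (w : I → I → ℝ) (f : I → ℝ) : I → ℝ :=
  fun x => ∫ y, w x y * f y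

/-- The operator of a bounded measurable kernel maps square integrable functions to square
integrable functions, so that its powers are the iterates of an operator on `L²[0,1]`. -/
theorem memLp_fredholm {w : I → I → ℝ} (hw : Measurable (Function.uncurry w))
    (hb : ∀ x y, w x y ∈ Set.Icc (0 : ℝ) 1) {f : I → ℝ} (hf : MemLp f 2 volume) :
    MemLp (fredholm w f) 2 volume := by
  have hint : Integrable f volume := hf.integrable (by norm_num)
  have hm : AEStronglyMeasurable (fredholm w f) volume := by
    have h : AEStronglyMeasurable (fun p : I × I => w p.1 p.2 * f p.2)
        ((volume : Measure I).prod volume) :=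
      (hw.aestronglyMeasurable).mul hf.1.comp_snd
    exact h.integral_prod_right'
  refine MemLp.of_bound hm (∫ y, ‖f y‖) (Filter.Eventually.of_forall fun x => ?_)
  refine norm_integral_le_of_norm_le hint.norm (Filter.Eventually.of_forall fun y => ?_)
  rw [norm_mul, Real.norm_of_nonneg (hb x y).1]
  exact mul_le_of_le_one_left (norm_nonneg _) (hb x y).2

/-- The filter `f ↦ h₀ f + ∑_{k=1}^K h_k T^k f` over the Fredholm operator `T` with kernel `w`. -/
def operatorFilter (K : ℕ) (h : ℕ → ℝ) (w : I → I → ℝ) (f : I → ℝ) : I → ℝ :=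
  fun t => h 0 * f t + ∑ k ∈ Finset.Icc 1 K, h k * (fredholm w)^[k] f t

/-- The indicator function of the strip `[i/N, (i+1)/N)`, for `i = 0, …, N-1`. -/
def stepBasis (N : ℕ) (i : Fin N) : I → ℝ :=
  Set.indicator {t : I | (i : ℝ) / N ≤ t ∧ (t : ℝ) < ((i : ℝ) + 1) / N} 1

/-- The step function on `[0,1]` with the value `x i` on the `i`-th strip. -/
def lift {N : ℕ} (x : Fin N → ℝ) : I → ℝ :=
  fun t => ∑ i, x i * stepBasis N i t

open Classical in
/-- The adjacency matrix of a graph. -/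
def adjacency {N : ℕ} (G : SimpleGraph (Fin N)) : Matrix (Fin N) (Fin N) ℝ :=
  G.adjMatrix ℝ

/-- The graph shift operator `S = (1/N) A`. -/
def shift {N : ℕ} (G : SimpleGraph (Fin N)) : Matrix (Fin N) (Fin N) ℝ :=
  (1 / (N : ℝ)) • adjacency G

/-- The simple polynomial graph filter `H = h₀ I + ∑_{k=1}^K h_k S^k`. -/
def graphFilter (K : ℕ) (h : ℕ → ℝ) {N : ℕ} (G : SimpleGraph (Fin N)) :
    Matrix (Fin N) (Fin N) ℝ :=
  h 0 • (1 : Matrix (Fin N) (Fin N) ℝ) + ∑ k ∈ Finset.Icc 1 K, h k • shift G ^ k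

/-- The empirical graphon of a graph: `1` on the product of the strips of two adjacent nodes and
`0` elsewhere. -/
def empirical {N : ℕ} (G : SimpleGraph (Fin N)) : I → I → ℝ :=
  fun s t => ∑ i, ∑ j, adjacency G i j * stepBasis N i s * stepBasis N j t

open Classical in
/-- The probability of the graph `g` when every pair of nodes `i < j` is joined independently
with probability `W(u i, u j)`. -/
def condProb (W : Graphon) {N : ℕ} (u : Fin N → I) (g : SimpleGraph (Fin N)) : ℝ :=
  ∏ i, ∏ j ∈ Finset.Ioi i, if g.Adj i j then W.ker (u i) (u j) else 1 - W.ker (u i) (u j)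

/-- `G` is a random graph with `N` nodes drawn from the graphon `W` with uniform samples: `N`
independent uniform samples `u` of `[0,1]` are drawn and put into increasing order
(`u ∘ Tuple.sort u`), and then nodes `i < j` are joined by independent Bernoulli trials whose
parameter is the value of `W` at the `i`-th and the `j`-th ordered sample. -/
structure IsSampledGraph {Ω : Type*} [MeasurableSpace Ω] (P : Measure Ω) (W : Graphon) (N : ℕ)
    (G : Ω → SimpleGraph (Fin N)) : Prop where
  measurableSet : ∀ g, MeasurableSet {ω | G ω = g}
  prob : ∀ g, P {ω | G ω = g} =
    ENNReal.ofReal (∫ u : Fin N → I, condProb W (u ∘ Tuple.sort u) g)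

/-- The coefficients of `f` with respect to the step functions: its mean over the `i`-th strip. -/
def stripMean (f : I → ℝ) (N : ℕ) (i : Fin N) : ℝ :=
  N * ∫ t, f t * stepBasis N i t

/-- The values that `f` takes on the closed strip `[i/N, (i+1)/N]`. -/
def stripValues (f : I → ℝ) (N : ℕ) (i : Fin N) : Set ℝ :=
  f '' {t : I | (i : ℝ) / N ≤ t ∧ (t : ℝ) ≤ ((i : ℝ) + 1) / N}

end

end GraphonFilter

open GraphonFilter

/-! The lift `lift` intertwines `shift G` with the Fredholm operator of the empirical graphon,
because a strip has length 1/N. This exact identity passes to polynomials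
(`lift_graphFilter_mulVec`), so the filters on signals become filters over the operators `T_e`.

It then suffices that almost surely `T_e f → T f` in L² for every f in L²
(`ae_tendsto_fredholm_empirical`). All operators involved are contractions, so strong convergence
survives powers, linear combinations and convergent inputs (`tendsto_operatorFilter`), and it needs
checking only on a countable dense set of continuous functions (`tendsto_fredholm_of_denseSeq`).

For one continuous f the L¹ error splits (`integral_abs_fredholm_sub_le`). The edge noise,
conditionally on the samples, is a sum of independent centred terms and obeys a Chernoff bound
(`sum_condProb_exists_abs_gt_le`). For the rest, the merely measurable kernel W is replaced by a
continuous V close to it in L¹: V at the ordered samples is close to V at the strip points, since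
order statistics are close to quantiles (`abs_sort_sub_le`), and the average of |W - V| over pairs
of samples is small by Hoeffding's inequality (`measure_pi_offDiag_sum_gt_le`).

Each failure probability is O(N exp(-cN)), which is summable. Borel–Cantelli therefore applies
without any knowledge of the joint law for different N, and boundedness upgrades L¹ to L². -/

namespace GraphonFilter

/-! ### Step functions on the strips and the exact filter identity. -/

section Strips

lemma strip_eq_Ico {N : ℕ} (i : Fin N) :
    {t : I | (i : ℝ) / N ≤ t ∧ (t : ℝ) < ((i : ℝ) + 1) / N} =
      Set.Ico ⟨(i : ℝ) / N, by positivity, by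
          rw [div_le_one (by exact_mod_cast i.pos)]; exact_mod_cast i.2.le⟩
        ⟨((i : ℝ) + 1) / N, by positivity, by
          rw [div_le_one (by exact_mod_cast i.pos)]; exact_mod_cast i.2⟩ := by
  ext t
  simp only [Set.mem_ofPred_eq, Set.mem_Ico, ← Subtype.coe_le_coe, ← Subtype.coe_lt_coe]

lemma measurableSet_strip {N : ℕ} (i : Fin N) :
    MeasurableSet {t : I | (i : ℝ) / N ≤ t ∧ (t : ℝ) < ((i : ℝ) + 1) / N} := by
  rw [strip_eq_Ico]; exact measurableSet_Ico

lemma volume_strip {N : ℕ} (i : Fin N) :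
    volume {t : I | (i : ℝ) / N ≤ t ∧ (t : ℝ) < ((i : ℝ) + 1) / N} = ENNReal.ofReal (1 / N) := by
  rw [strip_eq_Ico, unitInterval.volume_Ico]
  congr 1
  simp only
  ring

/-- Reading the strip index off a floor makes disjointness immediate. The point t = 1 has floor N
and lies in no strip, so every lift vanishes there. -/
lemma mem_strip_iff_floor {N : ℕ} (i : Fin N) (t : I) :
    ((i : ℝ) / N ≤ t ∧ (t : ℝ) < ((i : ℝ) + 1) / N) ↔ ⌊(N : ℝ) * t⌋₊ = i := by
  have hN : (0 : ℝ) < N := by exact_mod_cast i.pos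
  have ht := t.2.1
  rw [Nat.floor_eq_iff (by positivity), div_le_iff₀ hN, lt_div_iff₀ hN, mul_comm (N : ℝ)]

lemma stepBasis_eq_ite {N : ℕ} (i : Fin N) (t : I) :
    stepBasis N i t = if ⌊(N : ℝ) * t⌋₊ = i then 1 else 0 := by
  classical
  simp only [stepBasis, Set.indicator_apply, Set.mem_ofPred_eq, mem_strip_iff_floor, Pi.one_apply]

lemma measurable_stepBasis (N : ℕ) (i : Fin N) : Measurable (stepBasis N i) :=
  measurable_one.indicator (measurableSet_strip i)

lemma stepBasis_mem_Icc {N : ℕ} (i : Fin N) (t : I) : stepBasis N i t ∈ Set.Icc (0 : ℝ) 1 := by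
  rw [stepBasis_eq_ite]; split_ifs <;> simp

lemma stepBasis_mul_stepBasis {N : ℕ} (i j : Fin N) (t : I) :
    stepBasis N i t * stepBasis N j t = if i = j then stepBasis N i t else 0 := by
  simp only [stepBasis_eq_ite]
  by_cases hij : i = j
  · subst hij; simp
  · have : (i : ℕ) ≠ j := fun h => hij (Fin.ext h)
    rw [if_neg hij]
    split_ifs with h1 h2
    · exact absurd (h1.symm.trans h2) this
    all_goals simp

lemma integrable_stepBasis (N : ℕ) (i : Fin N) : Integrable (stepBasis N i) volume :=
  (integrable_const (1 : ℝ)).indicator (measurableSet_strip i)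

lemma integral_stepBasis {N : ℕ} (i : Fin N) : ∫ t, stepBasis N i t = 1 / N := by
  unfold stepBasis
  rw [integral_indicator_one (measurableSet_strip i), Measure.real, volume_strip,
    ENNReal.toReal_ofReal (by positivity)]

lemma measurable_lift {N : ℕ} (x : Fin N → ℝ) : Measurable (lift x) :=
  Finset.measurable_sum _ fun i _ => (measurable_stepBasis N i).const_mul _

lemma stepBasis_mul_lift {N : ℕ} (x : Fin N → ℝ) (i : Fin N) (t : I) :
    stepBasis N i t * lift x t = x i * stepBasis N i t := by
  simp only [lift, Finset.mul_sum]
  rw [Finset.sum_eq_single i]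
  · rw [mul_left_comm, stepBasis_mul_stepBasis, if_pos rfl]
  · intro j _ hj
    rw [mul_left_comm, stepBasis_mul_stepBasis, if_neg hj.symm, mul_zero]
  · simp

lemma memLp_lift {N : ℕ} (x : Fin N → ℝ) : MemLp (lift x) 2 volume := by
  refine MemLp.of_bound (measurable_lift x).aestronglyMeasurable (∑ i, ‖x i‖)
    (Eventually.of_forall fun t => (norm_sum_le _ _).trans (Finset.sum_le_sum fun i _ => ?_))
  have h := stepBasis_mem_Icc i t
  rw [norm_mul, Real.norm_of_nonneg h.1]
  exact mul_le_of_le_one_right (norm_nonneg _) h.2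

lemma fredholm_empirical_apply {N : ℕ} (G : SimpleGraph (Fin N)) {f : I → ℝ}
    (hf : Integrable f volume) (s : I) :
    fredholm (empirical G) f s =
      ∑ i, (∑ j, adjacency G i j * ∫ t, f t * stepBasis N j t) * stepBasis N i s := by
  have hint : ∀ j, Integrable (fun t => f t * stepBasis N j t) volume := fun j =>
    hf.mul_bdd (c := 1) (measurable_stepBasis N j).aestronglyMeasurable
      (Eventually.of_forall fun t => by
        have h := stepBasis_mem_Icc j t
        rw [Real.norm_of_nonneg h.1]; exact h.2)
  have h1 : ∀ t, empirical G s t * f t =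
      ∑ i, ∑ j, (adjacency G i j * stepBasis N i s) * (f t * stepBasis N j t) := by
    intro t
    simp only [empirical, Finset.sum_mul]
    exact Finset.sum_congr rfl fun i _ => Finset.sum_congr rfl fun j _ => by ring
  simp only [fredholm, h1]
  rw [integral_finsetSum _ fun i _ => integrable_finsetSum _ fun j _ => (hint j).const_mul _]
  refine Finset.sum_congr rfl fun i _ => ?_
  rw [integral_finsetSum _ fun j _ => (hint j).const_mul _, Finset.sum_mul]
  exact Finset.sum_congr rfl fun j _ => by rw [integral_const_mul]; ring

/-- The integral of `lift x` over the j-th strip is `x j / N`; this 1/N is the normalisation in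
`shift`. -/
lemma fredholm_empirical_lift {N : ℕ} (G : SimpleGraph (Fin N)) (x : Fin N → ℝ) :
    fredholm (empirical G) (lift x) = lift ((shift G).mulVec x) := by
  ext s
  rw [fredholm_empirical_apply G ((memLp_lift x).integrable (by norm_num))]
  refine Finset.sum_congr rfl fun i _ => ?_
  congr 1
  refine Finset.sum_congr rfl fun j _ => ?_
  simp only [mul_comm (lift x _), stepBasis_mul_lift, integral_const_mul, integral_stepBasis,
    shift, Matrix.smul_apply, smul_eq_mul]
  ring

lemma iterate_fredholm_empirical_lift {N : ℕ} (G : SimpleGraph (Fin N)) (x : Fin N → ℝ) (k : ℕ) :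
    (fredholm (empirical G))^[k] (lift x) = lift ((shift G ^ k).mulVec x) := by
  induction k with
  | zero => simp
  | succ k ih =>
    rw [Function.iterate_succ_apply', ih, fredholm_empirical_lift, Matrix.mulVec_mulVec, pow_succ']

lemma lift_add {N : ℕ} (x y : Fin N → ℝ) (t : I) : lift (x + y) t = lift x t + lift y t := by
  simp only [lift, Pi.add_apply, add_mul, Finset.sum_add_distrib]

lemma lift_smul {N : ℕ} (c : ℝ) (x : Fin N → ℝ) (t : I) : lift (c • x) t = c * lift x t := by
  simp only [lift, Pi.smul_apply, smul_eq_mul, mul_assoc, Finset.mul_sum]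

lemma lift_sum {N : ℕ} {ι : Type*} (s : Finset ι) (x : ι → Fin N → ℝ) (t : I) :
    lift (∑ k ∈ s, x k) t = ∑ k ∈ s, lift (x k) t := by
  simp only [lift, Finset.sum_apply, Finset.sum_mul]
  exact Finset.sum_comm

/-- The lifted output of a graph filter is the output of the empirical graphon filter. -/
theorem lift_graphFilter_mulVec (K : ℕ) (h : ℕ → ℝ) {N : ℕ} (G : SimpleGraph (Fin N))
    (x : Fin N → ℝ) :
    lift ((graphFilter K h G).mulVec x) = operatorFilter K h (empirical G) (lift x) := by
  ext t
  simp only [graphFilter, operatorFilter, Matrix.add_mulVec, Matrix.smul_mulVec, Matrix.one_mulVec,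
    Matrix.sum_mulVec, lift_add, lift_sum, lift_smul, iterate_fredholm_empirical_lift]

end Strips

/-! ### Concentration for functions of independent samples. -/

section Concentration

/-- Hoeffding's inequality for functions of independent samples. -/
lemma measure_pi_sum_ge_le {α : Type*} [MeasurableSpace α] (μ : Measure α) [IsProbabilityMeasure μ]
    {X : α → ℝ} (hX : Measurable X) {a b : ℝ} (hab : ∀ t, X t ∈ Set.Icc a b) (n : ℕ) {ε : ℝ}
    (hε : 0 ≤ ε) :
    Measure.pi (fun _ : Fin n => μ) {u | n * ε ≤ ∑ i, (X (u i) - ∫ t, X t ∂μ)} ≤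
      ENNReal.ofReal (Real.exp (-(2 * ε ^ 2 / (b - a) ^ 2) * n)) := by
  have hsub : ∀ i ∈ (Finset.univ : Finset (Fin n)), ProbabilityTheory.HasSubgaussianMGF
      (fun u : Fin n → α => X (u i) - ∫ t, X t ∂μ) ((‖b - a‖₊ / 2) ^ 2)
      (Measure.pi fun _ : Fin n => μ) := by
    intro i _
    have h := ProbabilityTheory.hasSubgaussianMGF_of_mem_Icc (μ := μ) hX.aemeasurable
      (Eventually.of_forall hab)
    have hmap : (Measure.pi fun _ : Fin n => μ).map (fun u => u i) = μ :=
      (measurePreserving_eval (fun _ : Fin n => μ) i).map_eq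
    rw [← hmap] at h
    have h2 := ProbabilityTheory.HasSubgaussianMGF.of_map (μ := Measure.pi fun _ : Fin n => μ)
      (Y := fun u => u i) (measurable_pi_apply i).aemeasurable h
    rw [hmap] at h2
    exact h2
  have hind : ProbabilityTheory.iIndepFun
      (fun (i : Fin n) (u : Fin n → α) => X (u i) - ∫ t, X t ∂μ)
      (Measure.pi fun _ : Fin n => μ) :=
    ProbabilityTheory.iIndepFun_pi (X := fun _ t => X t - ∫ t, X t ∂μ)
      fun _ => (hX.sub_const _).aemeasurable
  have h := ProbabilityTheory.HasSubgaussianMGF.measure_sum_ge_le_of_iIndepFun hind hsub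
    (ε := n * ε) (by positivity)
  rw [← ofReal_measureReal]
  refine ENNReal.ofReal_le_ofReal (h.trans (Real.exp_le_exp.2 (le_of_eq ?_)))
  simp only [Finset.sum_const, Finset.card_univ, Fintype.card_fin, nsmul_eq_mul, NNReal.coe_pow,
    NNReal.coe_div, NNReal.coe_mul, NNReal.coe_natCast, coe_nnnorm, NNReal.coe_ofNat, div_pow,
    Real.norm_eq_abs, sq_abs]
  -- In the degenerate cases n = 0 and b = a, division by zero being zero makes both exponents
  -- vanish.
  by_cases hn : (n : ℝ) = 0
  · simp [hn]
  by_cases hba : b - a = 0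
  · simp [hba]
  field_simp

lemma tsum_ofReal_mul_exp_ne_top {c : ℝ} (hc : 0 < c) (k : ℕ) :
    ∑' n : ℕ, ENNReal.ofReal ((n : ℝ) ^ k * Real.exp (-c * n)) ≠ ⊤ :=
  (Real.summable_pow_mul_exp_neg_nat_mul k hc).tsum_ofReal_ne_top

/-- Upper tail bound for the off-diagonal sum of a nonnegative kernel with small mean. -/
lemma measure_pi_offDiag_sum_gt_le {α : Type*} [MeasurableSpace α] (μ : Measure α)
    [IsProbabilityMeasure μ] {g : α → α → ℝ} (hg : Measurable (Function.uncurry g)) {C δ : ℝ}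
    (hgC : ∀ x y, g x y ∈ Set.Icc 0 C) (hδ : 0 < δ) (hgδ : ∫ x, ∫ y, g x y ∂μ ∂μ ≤ δ) (n : ℕ) :
    Measure.pi (fun _ : Fin (n + 1) => μ)
        {u | 3 * δ * ((n : ℝ) + 1) ^ 2 < ∑ i, ∑ k : Fin n, g (u i) (u (i.succAbove k))} ≤
      ((n : ENNReal) + 1) * ENNReal.ofReal (Real.exp (-(2 * δ ^ 2 / C ^ 2) * n)) +
        ENNReal.ofReal (Real.exp (-(2 * δ ^ 2 / C ^ 2) * (n + 1 : ℕ))) := by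
  set d : α → ℝ := fun x => ∫ y, g x y ∂μ with hd
  have hdm : Measurable d := (hg.stronglyMeasurable.integral_prod_right).measurable
  have hgx : ∀ x, Measurable (g x) := fun x => hg.comp measurable_prodMk_left
  have hgi : ∀ x, Integrable (g x) μ := fun x =>
    Integrable.of_mem_Icc 0 C (hgx x).aemeasurable (Eventually.of_forall (hgC x))
  have hdC : ∀ x, d x ∈ Set.Icc 0 C := fun x => by
    refine ⟨integral_nonneg fun y => (hgC x y).1, ?_⟩
    calc d x ≤ ∫ _, C ∂μ := integral_mono (hgi x) (integrable_const _) fun y => (hgC x y).2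
      _ = C := by simp
  -- `E i`: the i-th row sum exceeds its conditional mean given `u i` by `n * δ`. `F`: the row means
  -- `d (u i)` are too large in total.
  let E : Fin (n + 1) → Set (Fin (n + 1) → α) := fun i =>
    {u | n * δ ≤ ∑ k : Fin n, (g (u i) (u (i.succAbove k)) - d (u i))}
  let F : Set (Fin (n + 1) → α) := {u | (n + 1 : ℕ) * δ ≤ ∑ i, (d (u i) - ∫ x, d x ∂μ)}
  have hF : Measure.pi (fun _ : Fin (n + 1) => μ) F ≤
      ENNReal.ofReal (Real.exp (-(2 * δ ^ 2 / C ^ 2) * (n + 1 : ℕ))) := by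
    simpa only [sub_zero] using measure_pi_sum_ge_le μ hdm hdC (n + 1) hδ.le
  have hE : ∀ i, Measure.pi (fun _ : Fin (n + 1) => μ) (E i) ≤
      ENNReal.ofReal (Real.exp (-(2 * δ ^ 2 / C ^ 2) * n)) := by
    intro i
    let S : Set (α × (Fin n → α)) := {p | n * δ ≤ ∑ k : Fin n, (g p.1 (p.2 k) - d p.1)}
    have hS : MeasurableSet S := by
      refine measurableSet_le measurable_const (Finset.measurable_sum _ fun k _ => ?_)
      exact (hg.comp (measurable_fst.prodMk ((measurable_pi_apply k).comp measurable_snd))).sub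
        (hdm.comp measurable_fst)
    have hmp := measurePreserving_piFinSuccAbove (fun _ : Fin (n + 1) => μ) i
    -- Splitting off coordinate i leaves n independent samples, so Fubini reduces to Hoeffding's
    -- inequality for `g x` with x fixed. This is why the diagonal is excluded.
    have hpre : E i = (MeasurableEquiv.piFinSuccAbove (fun _ : Fin (n + 1) => α) i) ⁻¹' S := by
      ext u; rfl
    rw [hpre, hmp.measure_preimage hS.nullMeasurableSet, Measure.prod_apply hS]
    calc _ ≤ ∫⁻ _, ENNReal.ofReal (Real.exp (-(2 * δ ^ 2 / C ^ 2) * n)) ∂μ := by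
          refine lintegral_mono fun x => ?_
          have h := measure_pi_sum_ge_le μ (hgx x) (hgC x) n hδ.le
          rw [sub_zero] at h
          exact h
      _ = _ := by simp
  have hsub : {u : Fin (n + 1) → α |
      3 * δ * ((n : ℝ) + 1) ^ 2 < ∑ i, ∑ k : Fin n, g (u i) (u (i.succAbove k))} ⊆
      (⋃ i, E i) ∪ F := by
    intro u hu
    by_contra hcon
    simp only [Set.mem_union, Set.mem_iUnion, not_or, not_exists] at hcon
    obtain ⟨h1, h2⟩ := hcon
    simp only [E, F, Set.mem_ofPred_eq, not_le, Finset.sum_sub_distrib, Finset.sum_const,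
      Finset.card_univ, Fintype.card_fin, nsmul_eq_mul] at h1 h2 hu
    have hn : (0 : ℝ) ≤ n := n.cast_nonneg
    -- Off the bad events the rows cost one δ for their fluctuation, and the row means cost two: one
    -- for their mean, one for their fluctuation. Hence the factor 3.
    have h3 : ∑ i, ∑ k : Fin n, g (u i) (u (i.succAbove k)) ≤
        ∑ i, (((n : ℝ) + 1) * d (u i) + n * δ) := by
      refine Finset.sum_le_sum fun i _ => ?_
      have := h1 i
      have := (hdC (u i)).1
      linarith
    simp only [Finset.sum_add_distrib, ← Finset.mul_sum, Finset.sum_const, Finset.card_univ,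
      Fintype.card_fin, nsmul_eq_mul] at h3
    push_cast at h2 h3
    have h4 : ∑ i, d (u i) ≤ 2 * δ * ((n : ℝ) + 1) := by
      have : ((n : ℝ) + 1) * ∫ x, d x ∂μ ≤ ((n : ℝ) + 1) * δ := by gcongr
      linarith
    have h5 : ((n : ℝ) + 1) * ∑ i, d (u i) ≤ ((n : ℝ) + 1) * (2 * δ * ((n : ℝ) + 1)) := by gcongr
    nlinarith
  refine (measure_mono hsub).trans ((measure_union_le _ _).trans (add_le_add ?_ hF))
  refine (measure_iUnion_fintype_le _ _).trans ((Finset.sum_le_sum fun i _ => hE i).trans ?_)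
  simp

end Concentration

/-! ### Order statistics and quantiles. -/

section Quantiles

/-- If the empirical distribution function of `u` is `η`-close to the identity at the points `k/m`,
then the order statistics of `u` are close to the quantiles. -/
lemma abs_sort_sub_le {N m : ℕ} (hm : 0 < m) (u : Fin N → I) {η : ℝ}
    (hu : ∀ k ≤ m, |((Finset.univ.filter fun j => (u j : ℝ) ≤ k / m).card : ℝ) - N * (k / m)|
      ≤ N * η) (i : Fin N) :
    |((u ∘ Tuple.sort u) i : ℝ) - i / N| ≤ η + 1 / m := by
  set v := u ∘ Tuple.sort u with hv
  have hmono : Monotone v := Tuple.monotone_sort u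
  have hN : (0 : ℝ) < N := by exact_mod_cast i.pos
  have hm' : (0 : ℝ) < m := by exact_mod_cast hm
  have hcard : ∀ r : ℝ, (Finset.univ.filter fun j => (u j : ℝ) ≤ r).card =
      (Finset.univ.filter fun j => (v j : ℝ) ≤ r).card := by
    intro r
    refine (Finset.card_equiv (Tuple.sort u) fun j => ?_).symm
    simp [hv]
  -- Indices start at 0: the sorted entries 0, …, i give i + 1 samples up to r, while in `hupp` at
  -- most i samples lie at or below a point under `v i`.
  have hlow : ∀ r : ℝ, (v i : ℝ) ≤ r →
      (i : ℝ) + 1 ≤ (Finset.univ.filter fun j => (u j : ℝ) ≤ r).card := by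
    intro r hr
    have hsub : Finset.Iic i ⊆ Finset.univ.filter fun j => (v j : ℝ) ≤ r := by
      intro j hj
      simp only [Finset.mem_filter, Finset.mem_univ, true_and]
      exact le_trans (Subtype.coe_le_coe.2 (hmono (Finset.mem_Iic.1 hj))) hr
    have := Finset.card_le_card hsub
    rw [Fin.card_Iic, ← hcard] at this
    exact_mod_cast this
  have hupp : ∀ r : ℝ, r < v i →
      ((Finset.univ.filter fun j => (u j : ℝ) ≤ r).card : ℝ) ≤ i := by
    intro r hr
    have hsub : (Finset.univ.filter fun j => (v j : ℝ) ≤ r) ⊆ Finset.Iio i := by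
      intro j hj
      simp only [Finset.mem_filter, Finset.mem_univ, true_and] at hj
      rw [Finset.mem_Iio]
      by_contra hij
      exact absurd (lt_of_le_of_lt hj hr)
        (not_lt.2 (Subtype.coe_le_coe.2 (hmono (not_lt.1 hij))))
    have := Finset.card_le_card hsub
    rw [Fin.card_Iio, ← hcard] at this
    exact_mod_cast this
  have hv0 : (0 : ℝ) ≤ v i := (v i).2.1
  have hv1 : (v i : ℝ) ≤ 1 := (v i).2.2
  have hη : 0 ≤ η := by
    have := (abs_nonneg _).trans (hu 0 (Nat.zero_le _))
    exact nonneg_of_mul_nonneg_right this hN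
  have hmv : 0 ≤ (m : ℝ) * v i := by positivity
  -- The grid points (k-1)/m and k/m enclose `v i`; rounding to them costs the term 1/m.
  set k := ⌈(m : ℝ) * v i⌉₊ with hk
  have hkm : k ≤ m := by
    rw [hk, Nat.ceil_le]; nlinarith
  have hk1 : (m : ℝ) * v i ≤ k := Nat.le_ceil _
  have hk2 : (k : ℝ) < m * v i + 1 := Nat.ceil_lt_add_one hmv
  have hinv : (m : ℝ) * (1 / m) = 1 := by field_simp
  have hiN : (N : ℝ) * (i / N) = i := by field_simp
  rw [abs_sub_le_iff]
  constructor
  · rcases Nat.eq_zero_or_pos k with h0 | hpos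
    · have : (v i : ℝ) ≤ 0 := by
        rw [h0, Nat.cast_zero] at hk1
        exact nonpos_of_mul_nonpos_right hk1 hm'
      have : (0 : ℝ) ≤ i / N := by positivity
      have : (0 : ℝ) ≤ 1 / m := by positivity
      linarith
    · obtain ⟨l, hl⟩ : ∃ l, k = l + 1 := ⟨k - 1, by omega⟩
      have hlk : (k : ℝ) = l + 1 := by exact_mod_cast hl
      have h1 : (l : ℝ) / m < v i := by
        rw [div_lt_iff₀ hm']; linarith
      have h2 := hupp _ h1
      have h3 := (abs_sub_le_iff.1 (hu l (by omega))).2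
      have h4 : (v i : ℝ) ≤ l / m + 1 / m := by
        rw [← add_div, le_div_iff₀ hm']; linarith
      have h5 : (l : ℝ) / m ≤ i / N + η := by
        refine le_of_mul_le_mul_left ?_ hN
        linarith
      linarith
  · have h1 : (v i : ℝ) ≤ k / m := by
      rw [le_div_iff₀ hm']; linarith
    have h2 := hlow _ h1
    have h3 := (abs_sub_le_iff.1 (hu k hkm)).1
    have h4 : (k : ℝ) / m ≤ v i + 1 / m := by
      rw [div_le_iff₀ hm', add_mul, mul_comm (1 / (m : ℝ)), hinv]; linarith
    have h5 : (i : ℝ) / N ≤ k / m + η := by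
      refine le_of_mul_le_mul_left ?_ hN
      linarith
    linarith

/-- The count is a sum of independent indicators of mean r; Hoeffding's inequality for the indicator
and its negative gives the two tails. -/
lemma volume_abs_count_sub_gt_le (N : ℕ) {r : ℝ} (hr : r ∈ Set.Icc (0 : ℝ) 1) {η : ℝ}
    (hη : 0 < η) :
    volume {u : Fin N → I |
        N * η < |((Finset.univ.filter fun j => (u j : ℝ) ≤ r).card : ℝ) - N * r|} ≤
      2 * ENNReal.ofReal (Real.exp (-(2 * η ^ 2) * N)) := by
  classical
  have hS : MeasurableSet {t : I | (t : ℝ) ≤ r} :=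
    measurableSet_le measurable_subtype_coe measurable_const
  let X : I → ℝ := Set.indicator {t : I | (t : ℝ) ≤ r} 1
  have hX : Measurable X := measurable_one.indicator hS
  have hXint : ∫ t, X t = r := by
    have : {t : I | (t : ℝ) ≤ r} = Set.Iic ⟨r, hr⟩ := by ext t; exact Iff.rfl
    simp only [X]
    rw [integral_indicator_one hS, this, Measure.real, unitInterval.volume_Iic,
      ENNReal.toReal_ofReal hr.1]
  have hXmem : ∀ t, X t ∈ Set.Icc (0 : ℝ) 1 := fun t => by
    simp only [X, Set.indicator_apply]; split_ifs <;> simp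
  have hXneg : ∀ t, -X t ∈ Set.Icc (-1 : ℝ) 0 := fun t => by
    have := hXmem t; constructor <;> linarith [this.1, this.2]
  have hcount : ∀ u : Fin N → I,
      ((Finset.univ.filter fun j => (u j : ℝ) ≤ r).card : ℝ) = ∑ i, X (u i) := by
    intro u
    simp [X, Set.indicator_apply]
  have h1 := measure_pi_sum_ge_le (volume : Measure I) hX hXmem N hη.le
  have h2 := measure_pi_sum_ge_le (volume : Measure I) hX.neg hXneg N hη.le
  simp only [Pi.neg_apply, integral_neg, hXint] at h1 h2
  rw [sub_zero, one_pow, div_one] at h1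
  rw [zero_sub, neg_neg, one_pow, div_one] at h2
  rw [two_mul, volume_pi]
  refine (measure_mono ?_).trans ((measure_union_le _ _).trans (add_le_add h1 h2))
  intro u hu
  simp only [Set.mem_ofPred_eq, hcount, lt_abs] at hu
  simp only [Set.mem_union, Set.mem_ofPred_eq, Finset.sum_sub_distrib, Finset.sum_neg_distrib,
    Finset.sum_const, Finset.card_univ, Fintype.card_fin, nsmul_eq_mul]
  rcases hu with hu | hu
  · left; linarith
  · right; linarith

end Quantiles

/-! ### The edge noise, conditionally on the samples. -/

section RandomGraph

variable {N : ℕ}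

/-- The pairs `(i, j)` of nodes with `i < j`. -/
def edgePairs (N : ℕ) : Finset (Fin N × Fin N) := Finset.univ.filter fun p => p.1 < p.2

lemma mem_edgePairs {p : Fin N × Fin N} : p ∈ edgePairs N ↔ p.1 < p.2 := by simp [edgePairs]

open Classical in
-- Graphs correspond to subsets of `edgePairs N`, and the right side expands over these subsets.
-- This factorisation expresses the independence of the edges.
lemma sum_simpleGraph_prod (a b : Fin N × Fin N → ℝ) :
    ∑ g : SimpleGraph (Fin N), ∏ p ∈ edgePairs N, (if g.Adj p.1 p.2 then a p else b p) =
      ∏ p ∈ edgePairs N, (a p + b p) := by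
  rw [Finset.prod_add]
  refine Finset.sum_bij' (fun g _ => (edgePairs N).filter fun p => g.Adj p.1 p.2)
    (fun t _ => SimpleGraph.fromRel fun i j => (i, j) ∈ t) ?_ ?_ ?_ ?_ ?_
  · intro g _
    simp
  · intro t _
    simp
  · intro g _
    ext i j
    simp only [SimpleGraph.fromRel_adj, Finset.mem_filter, mem_edgePairs]
    constructor
    · rintro ⟨_, h | h⟩
      · exact h.2
      · exact h.2.symm
    · intro h
      refine ⟨h.ne, ?_⟩
      rcases lt_or_gt_of_ne h.ne with hij | hij
      · exact Or.inl ⟨hij, h⟩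
      · exact Or.inr ⟨hij, h.symm⟩
  · intro t ht
    rw [Finset.mem_powerset] at ht
    ext p
    simp only [SimpleGraph.fromRel_adj, Finset.mem_filter, mem_edgePairs]
    constructor
    · rintro ⟨hp, _, h | h⟩
      · exact h
      · exact absurd (mem_edgePairs.1 (ht h)) (not_lt.2 hp.le)
    · intro hp
      have := mem_edgePairs.1 (ht hp)
      exact ⟨this, this.ne, Or.inl hp⟩
  · intro g _
    rw [Finset.prod_ite, Finset.filter_not]

open Classical in
lemma condProb_eq_prod_edgePairs (W : Graphon) (v : Fin N → I) (g : SimpleGraph (Fin N)) :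
    condProb W v g = ∏ p ∈ edgePairs N,
      if g.Adj p.1 p.2 then W.ker (v p.1) (v p.2) else 1 - W.ker (v p.1) (v p.2) := by
  unfold condProb
  rw [← Finset.prod_finset_product' (edgePairs N) Finset.univ (fun i => Finset.Ioi i)
    (by simp [mem_edgePairs])]

lemma condProb_nonneg (W : Graphon) (v : Fin N → I) (g : SimpleGraph (Fin N)) :
    0 ≤ condProb W v g := by
  classical
  rw [condProb_eq_prod_edgePairs]
  refine Finset.prod_nonneg fun p _ => ?_
  have := W.mem_Icc (v p.1) (v p.2)
  split_ifs
  · exact this.1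
  · linarith [this.2]

lemma sum_condProb (W : Graphon) (v : Fin N → I) : ∑ g, condProb W v g = 1 := by
  classical
  simp only [condProb_eq_prod_edgePairs, sum_simpleGraph_prod]
  simp

/-- The coefficient of the pair `p` in a weighted sum over the neighbours of `i`. -/
def pairCoeff (i : Fin N) (c : Fin N → ℝ) (p : Fin N × Fin N) : ℝ :=
  (if p.1 = i then c p.2 else 0) + (if p.2 = i then c p.1 else 0)

/-- A row of a symmetric matrix is rewritten over unordered pairs, each of which carries one
independent edge. -/
lemma sum_edgePairs_pairCoeff_mul (i : Fin N) (c : Fin N → ℝ) {F : Fin N → Fin N → ℝ}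
    (hF : ∀ a b, F a b = F b a) (hF0 : ∀ a, F a a = 0) :
    ∑ p ∈ edgePairs N, pairCoeff i c p * F p.1 p.2 = ∑ j, F i j * c j := by
  have h : ∀ a b : Fin N, (if a < b then pairCoeff i c (a, b) * F a b else 0) =
      (if a = i then (if a < b then c b * F a b else 0) else 0) +
        (if b = i then (if a < b then c a * F a b else 0) else 0) := by
    intro a b
    simp only [pairCoeff, add_mul]
    split_ifs <;> simp
  rw [edgePairs, Finset.sum_filter, Fintype.sum_prod_type]
  simp only [h, Finset.sum_add_distrib, Finset.sum_ite_eq', Finset.mem_univ, if_true]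
  rw [Finset.sum_comm' (t' := Finset.univ) (s' := fun _ => Finset.univ) (by simp)]
  simp only [Finset.sum_ite_eq', Finset.mem_univ, if_true]
  rw [← Finset.sum_add_distrib]
  refine Finset.sum_congr rfl fun j _ => ?_
  rcases lt_trichotomy i j with hij | rfl | hij
  · rw [if_pos hij, if_neg hij.not_gt]; ring
  · simp [hF0]
  · rw [if_neg hij.not_gt, if_pos hij, hF j i]; ring

lemma abs_pairCoeff_le {i : Fin N} {c : Fin N → ℝ} {κ : ℝ} (hc : ∀ j, |c j| ≤ κ)
    {p : Fin N × Fin N} (hp : p ∈ edgePairs N) : |pairCoeff i c p| ≤ κ := by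
  have hne := (mem_edgePairs.1 hp).ne
  have hκ := (abs_nonneg _).trans (hc i)
  unfold pairCoeff
  split_ifs with h1 h2 h2
  · exact absurd (h1.trans h2.symm) hne
  · simpa using hc _
  · simpa using hc _
  · simpa using hκ

/-- At most one summand of `pairCoeff` is nonzero at a pair of distinct nodes, so squaring it
amounts to squaring c. Summing the row of the complete graph then gives the bound. -/
lemma sum_sq_pairCoeff_le (i : Fin N) {c : Fin N → ℝ} {κ : ℝ} (hc : ∀ j, |c j| ≤ κ) :
    ∑ p ∈ edgePairs N, pairCoeff i c p ^ 2 ≤ N * κ ^ 2 := by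
  have h := sum_edgePairs_pairCoeff_mul i (fun j => c j ^ 2)
    (F := fun a b => if a = b then 0 else 1) (fun a b => by simp [eq_comm]) (by simp)
  have h2 : ∑ p ∈ edgePairs N, pairCoeff i c p ^ 2 =
      ∑ p ∈ edgePairs N, pairCoeff i (fun j => c j ^ 2) p * if p.1 = p.2 then 0 else 1 := by
    refine Finset.sum_congr rfl fun p hp => ?_
    have hne := (mem_edgePairs.1 hp).ne
    rw [if_neg hne, mul_one]
    unfold pairCoeff
    split_ifs with h1 h2 h2
    · exact absurd (h1.trans h2.symm) hne
    all_goals simp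
  rw [h2, h]
  calc _ ≤ ∑ _j : Fin N, κ ^ 2 := by
        refine Finset.sum_le_sum fun j _ => ?_
        have : c j ^ 2 ≤ κ ^ 2 := sq_le_sq' (abs_le.1 (hc j)).1 (abs_le.1 (hc j)).2
        split_ifs
        · simpa using sq_nonneg κ
        · simpa using this
    _ = _ := by simp

/-- Use exp y ≤ 1 + y + y² for |y| ≤ 1: the linear terms cancel because the variable is centred, and
its variance w(1 - w) is at most 1. -/
lemma bernoulli_mgf_le {w x : ℝ} (hw : w ∈ Set.Icc (0 : ℝ) 1) (hx : |x| ≤ 1) :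
    w * Real.exp (x * (1 - w)) + (1 - w) * Real.exp (x * (0 - w)) ≤ Real.exp (x ^ 2) := by
  obtain ⟨h0, h1⟩ := hw
  have e1 : |x * (1 - w)| ≤ 1 := by
    rw [abs_mul, abs_of_nonneg (by linarith : 0 ≤ 1 - w)]
    exact mul_le_one₀ hx (by linarith) (by linarith)
  have e2 : |x * (0 - w)| ≤ 1 := by
    rw [abs_mul, zero_sub, abs_neg, abs_of_nonneg h0]
    exact mul_le_one₀ hx h0 h1
  have f1 := (abs_le.1 (Real.abs_exp_sub_one_sub_id_le e1)).2
  have f2 := (abs_le.1 (Real.abs_exp_sub_one_sub_id_le e2)).2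
  have f3 := Real.add_one_le_exp (x ^ 2)
  have g1 := mul_le_mul_of_nonneg_left f1 h0
  have g2 := mul_le_mul_of_nonneg_left f2 (by linarith : 0 ≤ 1 - w)
  have g3 : w * (x * (1 - w)) ^ 2 + (1 - w) * (x * (0 - w)) ^ 2 ≤ x ^ 2 := by
    have : w * (1 - w) ≤ 1 := by nlinarith
    calc _ = x ^ 2 * (w * (1 - w)) := by ring
      _ ≤ x ^ 2 * 1 := by gcongr
      _ = _ := mul_one _
  linarith

/-- The edge probabilities of the nodes with samples `v`, with zeros on the diagonal. -/
def edgeProb (W : Graphon) (v : Fin N → I) (i j : Fin N) : ℝ :=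
  if i = j then 0 else W.ker (v i) (v j)

lemma edgeProb_symm (W : Graphon) (v : Fin N → I) (i j : Fin N) :
    edgeProb W v i j = edgeProb W v j i := by
  simp only [edgeProb, eq_comm (a := i), W.symm (v i)]

lemma adjacency_symm (g : SimpleGraph (Fin N)) (i j : Fin N) :
    adjacency g i j = adjacency g j i := by
  classical
  simp only [adjacency, SimpleGraph.adjMatrix_apply, g.adj_comm i j]

lemma adjacency_self (g : SimpleGraph (Fin N)) (i : Fin N) : adjacency g i i = 0 := by
  simp [adjacency]

lemma adjacency_mem_Icc (g : SimpleGraph (Fin N)) (i j : Fin N) :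
    adjacency g i j ∈ Set.Icc (0 : ℝ) 1 := by
  classical
  simp only [adjacency, SimpleGraph.adjMatrix_apply]; split_ifs <;> simp

/-- Exponential moment bound for the weighted deviation of the degree of a node. -/
lemma sum_condProb_mul_exp_le (W : Graphon) (v : Fin N → I) (i : Fin N) {c : Fin N → ℝ} {κ l : ℝ}
    (hc : ∀ j, |c j| ≤ κ) (hl : 0 ≤ l) (hlκ : l * κ ≤ 1) :
    ∑ g, condProb W v g * Real.exp (l * ∑ j, (adjacency g i j - edgeProb W v i j) * c j) ≤
      Real.exp (l ^ 2 * (N * κ ^ 2)) := by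
  classical
  have h : ∀ g : SimpleGraph (Fin N),
      condProb W v g * Real.exp (l * ∑ j, (adjacency g i j - edgeProb W v i j) * c j) =
      ∏ p ∈ edgePairs N, if g.Adj p.1 p.2 then
        W.ker (v p.1) (v p.2) *
          Real.exp (l * pairCoeff i c p * (1 - W.ker (v p.1) (v p.2)))
        else (1 - W.ker (v p.1) (v p.2)) *
          Real.exp (l * pairCoeff i c p * (0 - W.ker (v p.1) (v p.2))) := by
    intro g
    rw [← sum_edgePairs_pairCoeff_mul i c (F := fun a b => adjacency g a b - edgeProb W v a b)
      (fun a b => by rw [adjacency_symm, edgeProb_symm])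
      (fun a => by simp [adjacency_self, edgeProb]),
      Finset.mul_sum, Real.exp_sum, condProb_eq_prod_edgePairs, ← Finset.prod_mul_distrib]
    refine Finset.prod_congr rfl fun p hp => ?_
    have hne := (mem_edgePairs.1 hp).ne
    simp only [adjacency, SimpleGraph.adjMatrix_apply, edgeProb, if_neg hne, ← mul_assoc]
    split_ifs <;> rfl
  simp only [h]
  rw [sum_simpleGraph_prod]
  calc _ ≤ ∏ p ∈ edgePairs N, Real.exp ((l * pairCoeff i c p) ^ 2) := by
        refine Finset.prod_le_prod (fun p _ => ?_) fun p hp => ?_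
        · have := W.mem_Icc (v p.1) (v p.2)
          have h1 : 0 ≤ 1 - W.ker (v p.1) (v p.2) := by linarith [this.2]
          have h0 := this.1
          positivity
        · refine bernoulli_mgf_le (W.mem_Icc _ _) ?_
          rw [abs_mul, abs_of_nonneg hl]
          exact (mul_le_mul_of_nonneg_left (abs_pairCoeff_le hc hp) hl).trans hlκ
    _ = Real.exp (l ^ 2 * ∑ p ∈ edgePairs N, pairCoeff i c p ^ 2) := by
        rw [← Real.exp_sum, Finset.mul_sum]
        simp only [mul_pow]
    _ ≤ _ := by
        gcongr
        exact sum_sq_pairCoeff_le i hc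

open Classical in
-- Chernoff's argument: Markov's inequality applied to the exponential moment.
lemma sum_condProb_ge_le (W : Graphon) (v : Fin N → I) (i : Fin N) {c : Fin N → ℝ} {κ l ε : ℝ}
    (hc : ∀ j, |c j| ≤ κ) (hl : 0 ≤ l) (hlκ : l * κ ≤ 1) :
    ∑ g with ε < ∑ j, (adjacency g i j - edgeProb W v i j) * c j, condProb W v g ≤
      Real.exp (l ^ 2 * (N * κ ^ 2) - l * ε) := by
  rw [Real.exp_sub, le_div_iff₀ (Real.exp_pos _), Finset.sum_mul]
  refine le_trans ?_ (sum_condProb_mul_exp_le W v i hc hl hlκ)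
  refine (Finset.sum_le_sum fun g hg => ?_).trans
    (Finset.sum_le_sum_of_subset_of_nonneg (Finset.filter_subset _ _) fun g _ _ =>
      mul_nonneg (condProb_nonneg W v g) (Real.exp_pos _).le)
  have := (Finset.mem_filter.1 hg).2
  have h0 := condProb_nonneg W v g
  gcongr

open Classical in
/-- Given the samples, the weighted degrees of all nodes are close to their means, up to an
exponentially small probability. -/
lemma sum_condProb_exists_abs_gt_le {M ε : ℝ} (hM : 0 < M) (hε : 0 < ε) :
    ∃ κ > 0, ∀ (W : Graphon) (N : ℕ) (v : Fin N → I) (c : Fin N → ℝ), (∀ j, |c j| ≤ M / N) →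
      ∑ g with ∃ i, ε < |∑ j, (adjacency g i j - edgeProb W v i j) * c j|, condProb W v g ≤
        2 * (N * Real.exp (-κ * N)) := by
  -- With l = θN and weights at most M/N, the first bound on θ gives l·(M/N) ≤ 1, and the second
  -- makes the quadratic term of the exponent at most half of lε. The resulting rate depends on M
  -- and ε only, hence is uniform in the samples.
  set θ := min (1 / M) (ε / (2 * M ^ 2)) with hθ
  have hθ0 : 0 < θ := by positivity
  have hθ1 : θ * M ≤ 1 := by
    rw [← le_div_iff₀ hM]; exact min_le_left _ _
  have hθ2 : θ * M ^ 2 ≤ ε / 2 := by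
    have : θ ≤ ε / (2 * M ^ 2) := min_le_right _ _
    rw [le_div_iff₀ (by positivity)] at this
    linarith
  refine ⟨θ * ε / 2, by positivity, fun W N v c hc => ?_⟩
  have key : ∀ (i : Fin N) (c : Fin N → ℝ), (∀ j, |c j| ≤ M / N) →
      ∑ g with ε < ∑ j, (adjacency g i j - edgeProb W v i j) * c j, condProb W v g ≤
        Real.exp (-(θ * ε / 2) * N) := by
    intro i c hc
    have hN : (0 : ℝ) < N := by exact_mod_cast i.pos
    refine (sum_condProb_ge_le W v i hc (l := θ * N) (by positivity) ?_).trans ?_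
    · calc θ * N * (M / N) = θ * M := by field_simp
        _ ≤ 1 := hθ1
    · refine Real.exp_le_exp.2 ?_
      have e1 : (θ * N) ^ 2 * (N * (M / N) ^ 2) = θ * N * (θ * M ^ 2) := by field_simp
      have e2 : θ * N * (θ * M ^ 2) ≤ θ * N * (ε / 2) := by gcongr
      rw [e1]
      linarith
  calc _ ≤ ∑ i, (∑ g with ε < ∑ j, (adjacency g i j - edgeProb W v i j) * c j, condProb W v g +
        ∑ g with ε < ∑ j, (adjacency g i j - edgeProb W v i j) * (-c j), condProb W v g) := by
        simp only [Finset.sum_filter, ← Finset.sum_add_distrib]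
        rw [Finset.sum_comm]
        refine Finset.sum_le_sum fun g _ => ?_
        have h0 := condProb_nonneg W v g
        have hterm : ∀ i, 0 ≤
            (if ε < ∑ j, (adjacency g i j - edgeProb W v i j) * c j then condProb W v g else 0) +
            (if ε < ∑ j, (adjacency g i j - edgeProb W v i j) * (-c j)
              then condProb W v g else 0) := by
          intro i
          split_ifs <;> positivity
        split_ifs with hg
        · obtain ⟨i, hi⟩ := hg
          refine le_trans ?_ (Finset.single_le_sum (fun i _ => hterm i) (Finset.mem_univ i))
          simp only [mul_neg, Finset.sum_neg_distrib]
          rcases lt_abs.1 hi with h | h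
          · rw [if_pos h]
            split_ifs <;> linarith
          · rw [if_pos h]
            split_ifs <;> linarith
        · exact Finset.sum_nonneg fun i _ => hterm i
    _ ≤ ∑ _i : Fin N, (Real.exp (-(θ * ε / 2) * N) + Real.exp (-(θ * ε / 2) * N)) := by
        refine Finset.sum_le_sum fun i _ => add_le_add (key i c hc) (key i _ fun j => ?_)
        rw [abs_neg]; exact hc j
    _ = _ := by
        simp only [Finset.sum_const, Finset.card_univ, Fintype.card_fin, nsmul_eq_mul]; ring

end RandomGraph

/-! ### Deterministic error bound for the empirical operator. -/

section Cells

variable {N : ℕ}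

/-- The index of the strip that contains `t`, for `t < 1`. -/
noncomputable def cell (hN : 0 < N) (t : I) : Fin N := ⟨⌊(N : ℝ) * t⌋₊ % N, Nat.mod_lt _ hN⟩

lemma floor_eq_cell (hN : 0 < N) {t : I} (ht : t < 1) : ⌊(N : ℝ) * t⌋₊ = cell hN t := by
  have hN' : (0 : ℝ) < N := by exact_mod_cast hN
  have ht' : (t : ℝ) < 1 := ht
  refine (Nat.mod_eq_of_lt ((Nat.floor_lt ?_).2 ?_)).symm
  · have := t.2.1; positivity
  · nlinarith

lemma cell_div_le (hN : 0 < N) {t : I} (ht : t < 1) :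
    (cell hN t : ℝ) / N ≤ t ∧ (t : ℝ) < ((cell hN t : ℝ) + 1) / N :=
  (mem_strip_iff_floor (cell hN t) t).2 (floor_eq_cell hN ht)

lemma lift_eq_cell (hN : 0 < N) (x : Fin N → ℝ) {t : I} (ht : t < 1) :
    lift x t = x (cell hN t) := by
  simp only [lift, stepBasis_eq_ite, floor_eq_cell hN ht, ← Fin.ext_iff]
  simp

lemma ae_lt_one : ∀ᵐ t : I, t < 1 := by
  have : ∀ᵐ t : I, t ≠ 1 := by simp [ae_iff]
  filter_upwards [this] with t ht using lt_of_le_of_ne t.2.2 ht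

lemma integral_lift (x : Fin N → ℝ) : ∫ t, lift x t = (∑ i, x i) / N := by
  simp only [lift]
  rw [integral_finsetSum _ fun i _ => (integrable_stepBasis N i).const_mul _]
  simp only [integral_const_mul, integral_stepBasis, Finset.sum_div]
  exact Finset.sum_congr rfl fun i _ => by ring

lemma integrable_lift (x : Fin N → ℝ) : Integrable (lift x) volume :=
  (memLp_lift x).integrable (by norm_num)

lemma integral_lift_mul (x : Fin N → ℝ) {f : I → ℝ} (hf : Integrable f volume) :
    ∫ t, lift x t * f t = ∑ j, x j * ∫ t, f t * stepBasis N j t := by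
  have hint : ∀ j, Integrable (fun t => f t * stepBasis N j t) volume := fun j =>
    hf.mul_bdd (c := 1) (measurable_stepBasis N j).aestronglyMeasurable
      (Eventually.of_forall fun t => by
        have h := stepBasis_mem_Icc j t
        rw [Real.norm_of_nonneg h.1]; exact h.2)
  have h1 : ∀ t, lift x t * f t = ∑ j, x j * (f t * stepBasis N j t) := by
    intro t
    simp only [lift, Finset.sum_mul]
    exact Finset.sum_congr rfl fun j _ => by ring
  simp only [h1]
  rw [integral_finsetSum _ fun j _ => (hint j).const_mul _]
  simp only [integral_const_mul]

lemma abs_integral_mul_stepBasis_le {f : I → ℝ} {M : ℝ} (hM : ∀ t, |f t| ≤ M) (j : Fin N) :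
    |∫ t, f t * stepBasis N j t| ≤ M / N := by
  have h : ‖∫ t, f t * stepBasis N j t‖ ≤ ∫ t, M * stepBasis N j t := by
    refine norm_integral_le_of_norm_le ((integrable_stepBasis N j).const_mul M)
      (Eventually.of_forall fun t => ?_)
    have h0 := (stepBasis_mem_Icc j t).1
    rw [norm_mul, Real.norm_of_nonneg h0]
    exact mul_le_mul_of_nonneg_right (hM t) h0
  rw [integral_const_mul, integral_stepBasis] at h
  simpa [div_eq_mul_inv] using h

lemma integrable_uncurry_sub {W : Graphon} {V : I → I → ℝ} (hV : Measurable (Function.uncurry V))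
    {C : ℝ} (hC : ∀ x y, |W.ker x y - V x y| ≤ C) :
    Integrable (fun p : I × I => |W.ker p.1 p.2 - V p.1 p.2|) (volume.prod volume) := by
  refine Integrable.of_bound (C := C) ?_ (Eventually.of_forall fun p => ?_)
  · exact ((W.measurable_ker.sub hV).abs).aestronglyMeasurable
  · simpa using hC p.1 p.2

/-- Deterministic bound for the distance between the empirical and the true operator. -/
lemma integral_abs_fredholm_sub_le (W : Graphon) (hN : 0 < N) (g : SimpleGraph (Fin N))
    (v : Fin N → I) {V : I → I → ℝ} (hV : Measurable (Function.uncurry V)) {C : ℝ}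
    (hC : ∀ x y, |W.ker x y - V x y| ≤ C) {f : I → ℝ} (hf : AEStronglyMeasurable f volume) {M : ℝ}
    (hM : ∀ t, |f t| ≤ M) {ε r S δ : ℝ}
    (h1 : ∀ i, |∑ j, (adjacency g i j - edgeProb W v i j) * ∫ t, f t * stepBasis N j t| ≤ ε)
    (h2 : ∀ s t, s < 1 → t < 1 → |V (v (cell hN s)) (v (cell hN t)) - V s t| ≤ r)
    (h3 : ∑ i, ∑ j, (if i = j then 0 else |W.ker (v i) (v j) - V (v i) (v j)|) ≤ S * N ^ 2)
    (h4 : ∫ x, ∫ y, |W.ker x y - V x y| ≤ δ) :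
    ∫ s, |fredholm (empirical g) f s - fredholm W.ker f s| ≤ ε + M * (1 / N + S + r + δ) := by
  have hN' : (0 : ℝ) < N := by exact_mod_cast hN
  have hM0 : 0 ≤ M := (abs_nonneg _).trans (hM 0)
  have hr0 : 0 ≤ r := (abs_nonneg _).trans (h2 0 0 zero_lt_one zero_lt_one)
  have hfi : Integrable f volume :=
    Integrable.of_bound (C := M) hf (Eventually.of_forall fun t => by simpa using hM t)
  -- The diagonal value 1 bounds the error from the missing loops, where `edgeProb` is 0 and W is at
  -- most 1; it produces the term 1/N.
  let k : Fin N → Fin N → ℝ := fun i j =>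
    if i = j then 1 else |W.ker (v i) (v j) - V (v i) (v j)|
  let d : I → ℝ := fun x => ∫ y, |W.ker x y - V x y|
  have hdiff := integrable_uncurry_sub hV hC
  have hdi : Integrable d volume := hdiff.integral_prod_left
  have hdx : ∀ x, Integrable (fun y => |W.ker x y - V x y|) volume := fun x => by
    refine Integrable.of_bound (C := C) ?_ (Eventually.of_forall fun y => ?_)
    · exact (((W.measurable_ker.sub hV).abs).comp measurable_prodMk_left).aestronglyMeasurable
    · simpa using hC x y
  have hWf : ∀ s, Integrable (fun t => W.ker s t * f t) volume := fun s =>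
    hfi.bdd_mul (c := 1) (W.measurable_ker.comp measurable_prodMk_left).aestronglyMeasurable
      (Eventually.of_forall fun t => by
        rw [Real.norm_of_nonneg (W.mem_Icc s t).1]
        exact (W.mem_Icc s t).2)
  have hLf : ∀ i, Integrable (fun t => lift (edgeProb W v i) t * f t) volume := fun i => by
    have := (memLp_lift (edgeProb W v i)).integrable_mul
      (MemLp.of_bound (p := 2) hf M (Eventually.of_forall fun t => by simpa using hM t))
    exact this
  have hint : ∀ {A D : I → ℝ}, Integrable A volume → Integrable D volume →
      ∫ t, (A t + r + D t) = (∫ t, A t) + r + ∫ t, D t := by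
    intro A D hA hD
    have h := integral_add (hA.add (integrable_const r)) hD
    simp only [Pi.add_apply] at h
    rw [h, integral_add hA (integrable_const r)]
    simp
  have hpt : ∀ s : I, s < 1 → |fredholm (empirical g) f s - fredholm W.ker f s| ≤
      ε + M * (lift (fun i => (∑ j, k i j) / N) s + r + d s) := by
    intro s hs
    set i := cell hN s with hi
    have e1 : fredholm (empirical g) f s = ∑ j, adjacency g i j * ∫ t, f t * stepBasis N j t := by
      rw [fredholm_empirical_apply g hfi]
      exact lift_eq_cell hN (fun i => ∑ j, adjacency g i j * ∫ t, f t * stepBasis N j t) hs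
    -- The first sum is the edge noise, controlled by `h1`; the integral is the sampling error,
    -- estimated through V.
    have e2 : fredholm (empirical g) f s - fredholm W.ker f s =
        (∑ j, (adjacency g i j - edgeProb W v i j) * ∫ t, f t * stepBasis N j t) +
        ∫ t, (lift (edgeProb W v i) t * f t - W.ker s t * f t) := by
      rw [integral_sub (hLf i) (hWf s), integral_lift_mul _ hfi, e1, fredholm]
      simp only [sub_mul, Finset.sum_sub_distrib]
      ring
    have e3 : ‖∫ t, (lift (edgeProb W v i) t * f t - W.ker s t * f t)‖ ≤
        ∫ t, M * (lift (k i) t + r + |W.ker s t - V s t|) := by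
      refine norm_integral_le_of_norm_le
        ((((integrable_lift (k i)).add (integrable_const r)).add (hdx s)).const_mul M) ?_
      filter_upwards [ae_lt_one] with t ht
      rw [← sub_mul, norm_mul, mul_comm, lift_eq_cell hN _ ht, lift_eq_cell hN _ ht]
      refine mul_le_mul (hM t) ?_ (norm_nonneg _) hM0
      have hv := h2 s t hs ht
      rw [← hi] at hv
      simp only [k, edgeProb, Real.norm_eq_abs]
      split_ifs with hij
      · rw [zero_sub, abs_neg, abs_of_nonneg (W.mem_Icc s t).1]
        have := (W.mem_Icc s t).2
        have := abs_nonneg (W.ker s t - V s t)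
        linarith
      · set j := cell hN t
        have a1 := abs_add_le (W.ker (v i) (v j) - V (v i) (v j)) (V (v i) (v j) - W.ker s t)
        have a2 := abs_add_le (V (v i) (v j) - V s t) (V s t - W.ker s t)
        rw [sub_add_sub_cancel] at a1 a2
        rw [abs_sub_comm (V s t)] at a2
        linarith
    rw [integral_const_mul, hint (integrable_lift (k i)) (hdx s), integral_lift] at e3
    rw [e2, lift_eq_cell hN _ hs, ← hi]
    refine (abs_add_le _ _).trans (add_le_add (h1 i) ?_)
    exact e3
  have hKi := integrable_lift (fun i => (∑ j, k i j) / N)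
  have hRM : Integrable (fun s => M * (lift (fun i => (∑ j, k i j) / N) s + r + d s)) volume :=
    ((hKi.add (integrable_const r)).add hdi).const_mul M
  have hR : Integrable (fun s => ε + M * (lift (fun i => (∑ j, k i j) / N) s + r + d s)) volume :=
    (integrable_const ε).add hRM
  have hmono := integral_mono_of_nonneg
    (Eventually.of_forall fun s => abs_nonneg (fredholm (empirical g) f s - fredholm W.ker f s)) hR
    (by filter_upwards [ae_lt_one] with s hs using hpt s hs)
  refine hmono.trans ?_
  rw [integral_add (integrable_const ε) hRM, integral_const_mul, hint hKi hdi, integral_lift]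
  simp only [integral_const, probReal_univ, one_smul]
  have hsum : (∑ i, (∑ j, k i j) / N) / N ≤ 1 / N + S := by
    have hk : ∀ i j, k i j = (if i = j then 1 else 0) +
        (if i = j then 0 else |W.ker (v i) (v j) - V (v i) (v j)|) := by
      intro i j
      simp only [k]
      split_ifs <;> simp
    rw [← Finset.sum_div, div_div, div_le_iff₀ (by positivity)]
    simp only [hk, Finset.sum_add_distrib, Finset.sum_ite_eq, Finset.mem_univ, if_true,
      Finset.sum_const, Finset.card_univ, Fintype.card_fin, nsmul_eq_mul, mul_one]
    have : (1 / (N : ℝ) + S) * (N * N) = N + S * N ^ 2 := by field_simp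
    linarith
  gcongr

end Cells

/-! ### From tail bounds to almost sure convergence in L¹. -/

section AlmostSure

/-- A non-integrable function has Bochner integral 0, so no measurability is needed. Together with
superadditivity of the lower integral this spares proving that sorting the samples is measurable. -/
lemma ofReal_integral_le_lintegral_ofReal {α : Type*} [MeasurableSpace α] (μ : Measure α)
    {f : α → ℝ} (hf : ∀ x, 0 ≤ f x) :
    ENNReal.ofReal (∫ x, f x ∂μ) ≤ ∫⁻ x, ENNReal.ofReal (f x) ∂μ := by
  by_cases hi : Integrable f μ
  · rw [ofReal_integral_eq_lintegral_ofReal hi (Eventually.of_forall hf)]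
  · simp [integral_undef hi]

lemma sum_lintegral_le_lintegral_sum {α ι : Type*} [MeasurableSpace α] (μ : Measure α)
    (s : Finset ι) (f : ι → α → ENNReal) :
    ∑ i ∈ s, ∫⁻ x, f i x ∂μ ≤ ∫⁻ x, ∑ i ∈ s, f i x ∂μ := by
  classical
  induction s using Finset.induction_on with
  | empty => simp
  | insert i s hi ih =>
    simp only [Finset.sum_insert hi]
    exact (add_le_add le_rfl ih).trans (le_lintegral_add _ _)

/-- A conditional probability bound outside a set of bad samples bounds the probability of an event
for the random graph. -/
lemma IsSampledGraph.measure_mem_le {Ω : Type*} [MeasurableSpace Ω] {P : Measure Ω} {W : Graphon}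
    {N : ℕ} {G : Ω → SimpleGraph (Fin N)} (hG : IsSampledGraph P W N G)
    (B : SimpleGraph (Fin N) → Prop) [DecidablePred B] (bad : Set (Fin N → I)) {q : ℝ}
    (hq : ∀ u ∉ bad, ∑ g with B g, condProb W (u ∘ Tuple.sort u) g ≤ q) :
    P {ω | B (G ω)} ≤ ENNReal.ofReal q + volume bad := by
  have hsub : {ω | B (G ω)} ⊆ ⋃ g ∈ Finset.univ.filter B, {ω | G ω = g} := by
    intro ω hω
    simpa using hω
  calc P {ω | B (G ω)} ≤ ∑ g with B g, P {ω | G ω = g} :=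
        (measure_mono hsub).trans (measure_biUnion_finset_le _ _)
    _ ≤ ∑ g with B g,
        ∫⁻ u : Fin N → I, ENNReal.ofReal (condProb W (u ∘ Tuple.sort u) g) :=
        Finset.sum_le_sum fun g _ => by
          rw [hG.prob g]
          exact ofReal_integral_le_lintegral_ofReal _ fun u => condProb_nonneg W _ g
    _ ≤ ∫⁻ u : Fin N → I, ∑ g with B g, ENNReal.ofReal (condProb W (u ∘ Tuple.sort u) g) :=
        sum_lintegral_le_lintegral_sum _ _ _
    _ ≤ ∫⁻ u : Fin N → I, (ENNReal.ofReal q + bad.indicator (fun _ => 1) u) := by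
        refine lintegral_mono fun u => ?_
        rw [← ENNReal.ofReal_sum_of_nonneg fun g _ => condProb_nonneg W _ g]
        -- At bad samples the conditional probability is bounded by the total weight 1.
        by_cases hu : u ∈ bad
        · rw [Set.indicator_of_mem hu]
          refine le_trans ?_ le_add_self
          rw [← ENNReal.ofReal_one, ← sum_condProb W (u ∘ Tuple.sort u)]
          exact ENNReal.ofReal_le_ofReal (Finset.sum_le_sum_of_subset_of_nonneg
            (Finset.filter_subset _ _) fun g _ _ => condProb_nonneg W _ g)
        · exact (ENNReal.ofReal_le_ofReal (hq u hu)).trans le_self_add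
    _ = ENNReal.ofReal q + ∫⁻ u : Fin N → I, bad.indicator (fun _ => 1) u := by
        rw [lintegral_add_left measurable_const]
        simp
    _ ≤ ENNReal.ofReal q + volume bad := by
        gcongr
        simpa using lintegral_indicator_const_le bad (1 : ENNReal)

/-- A sum over all pairs of distinct nodes ignores the order, so the ordered samples may be replaced
by the independent ones. -/
lemma sum_comp_perm_offDiag {N : ℕ} {α : Type*} (u : Fin N → α) (τ : Equiv.Perm (Fin N))
    (g : α → α → ℝ) :
    ∑ i, ∑ j, (if i = j then 0 else g ((u ∘ τ) i) ((u ∘ τ) j)) =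
      ∑ i, ∑ j, (if i = j then 0 else g (u i) (u j)) := by
  rw [← Equiv.sum_comp τ (fun i => ∑ j, (if i = j then 0 else g (u i) (u j)))]
  refine Finset.sum_congr rfl fun i _ => ?_
  rw [← Equiv.sum_comp τ (fun j => if τ i = j then 0 else g (u (τ i)) (u j))]
  simp [τ.injective.eq_iff]

lemma sum_offDiag_eq_sum_succAbove {n : ℕ} {α : Type*} (u : Fin (n + 1) → α) (g : α → α → ℝ) :
    ∑ i, ∑ j, (if i = j then 0 else g (u i) (u j)) =
      ∑ i, ∑ k : Fin n, g (u i) (u (i.succAbove k)) := by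
  refine Finset.sum_congr rfl fun i _ => ?_
  rw [Fin.sum_univ_succAbove _ i]
  simp [(Fin.succAbove_ne i _).symm]

lemma tsum_succ_mul_ofReal_exp_ne_top {c : ℝ} (hc : 0 < c) :
    ∑' n : ℕ, ((n : ENNReal) + 1) * ENNReal.ofReal (Real.exp (-c * n)) ≠ ⊤ := by
  have h : ∀ n : ℕ, ((n : ENNReal) + 1) * ENNReal.ofReal (Real.exp (-c * n)) =
      ENNReal.ofReal ((n : ℝ) ^ 1 * Real.exp (-c * n)) +
        ENNReal.ofReal ((n : ℝ) ^ 0 * Real.exp (-c * n)) := by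
    intro n
    rw [pow_one, pow_zero, one_mul, ENNReal.ofReal_mul n.cast_nonneg, ENNReal.ofReal_natCast,
      add_mul, one_mul]
  simp only [h]
  rw [ENNReal.tsum_add]
  exact ENNReal.add_ne_top.2
    ⟨tsum_ofReal_mul_exp_ne_top hc 1, tsum_ofReal_mul_exp_ne_top hc 0⟩

lemma exists_continuous_integral_abs_sub_le (W : Graphon) {δ : ℝ} (hδ : 0 < δ) :
    ∃ V : C(I × I, ℝ), ∫ x, ∫ y, |W.ker x y - V (x, y)| ≤ δ := by
  have hWi : Integrable (Function.uncurry W.ker) ((volume : Measure I).prod volume) :=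
    Integrable.of_mem_Icc 0 1 W.measurable_ker.aemeasurable
      (Eventually.of_forall fun p => W.mem_Icc p.1 p.2)
  obtain ⟨V, hV, hVi⟩ := hWi.exists_boundedContinuous_integral_sub_le hδ
  refine ⟨V.toContinuousMap, ?_⟩
  have h := integral_prod _ (hWi.sub hVi).norm
  simp only [Pi.sub_apply] at h
  rw [h] at hV
  exact hV

/-- The `L¹` distance between the outputs of the empirical and of the true operator exceeds any
`ε > 0` only finitely often. -/
lemma ae_eventually_integral_abs_fredholm_sub_le {Ω : Type*} [MeasurableSpace Ω] (P : Measure Ω)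
    (W : Graphon) (G : (N : ℕ) → Ω → SimpleGraph (Fin N))
    (hG : ∀ N, IsSampledGraph P W N (G N)) (f : C(I, ℝ)) {ε : ℝ} (hε : 0 < ε) :
    ∀ᵐ ω ∂P, ∀ᶠ N in atTop,
      ∫ s, |fredholm (empirical (G N ω)) f s - fredholm W.ker f s| ≤ ε := by
  classical
  obtain ⟨M, hM0, hM⟩ : ∃ M : ℝ, 0 < M ∧ ∀ t, |f t| ≤ M :=
    ⟨‖f‖ + 1, by positivity, fun t => (f.norm_coe_le_norm t).trans (by linarith)⟩
  -- Error budget: ε/4 for edge noise, 4Mδ = ε/4 for W against V, Mr = ε/8 for the oscillation of V,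
  -- and at most ε/8 for the diagonal. The total is 3ε/4.
  set δ := ε / (16 * M) with hδ
  have hδ0 : 0 < δ := by positivity
  obtain ⟨V, hVδ⟩ := exists_continuous_integral_abs_sub_le W hδ0
  have hVm : Measurable (Function.uncurry fun x y => V (x, y)) := V.continuous.measurable
  set C := 1 + ‖V‖ with hCdef
  have hC0 : 0 < C := by positivity
  have hC : ∀ x y, |W.ker x y - V (x, y)| ≤ C := fun x y => by
    refine (abs_sub _ _).trans (add_le_add ?_ (V.norm_coe_le_norm _))
    rw [abs_of_nonneg (W.mem_Icc x y).1]
    exact (W.mem_Icc x y).2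
  set r := ε / (8 * M) with hr
  have hr0 : 0 < r := by positivity
  obtain ⟨ρ, hρ0, hρ⟩ := Metric.uniformContinuous_iff.1
    (CompactSpace.uniformContinuous_of_continuous V.continuous) r hr0
  -- Empirical distribution error η, grid width 1/m and strip width 1/N each use at most ρ/4, so
  -- samples stay within ρ of the points of their strips.
  set η := ρ / 4 with hη
  have hη0 : 0 < η := by positivity
  obtain ⟨m, hm⟩ := exists_nat_gt (4 / ρ)
  have hm0' : (0 : ℝ) < m := lt_trans (by positivity) hm
  have hm0 : 0 < m := by exact_mod_cast hm0'
  have hmρ : 1 / (m : ℝ) < ρ / 4 := by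
    rw [div_lt_iff₀ hρ0] at hm
    rw [div_lt_iff₀ hm0']; linarith
  obtain ⟨κ, hκ0, hκ⟩ := sum_condProb_exists_abs_gt_le hM0 (by positivity : 0 < ε / 4)
  set c := min κ (min (2 * η ^ 2) (2 * δ ^ 2 / C ^ 2)) with hc
  have hc0 : 0 < c := by positivity
  obtain ⟨N₀, hN₀⟩ := exists_nat_gt (max (4 / ρ) (1 / r))
  -- Including `N₀ ≤ N` makes the event empty for small N, so the tail bound holds for every n.
  let B : (N : ℕ) → SimpleGraph (Fin N) → Prop := fun N g =>
    N₀ ≤ N ∧ ε < ∫ s, |fredholm (empirical g) f s - fredholm W.ker f s|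
  -- The constant collects 2 for the edge noise, 2 for each of the m + 1 grid points, and 2 for the
  -- pair sum of |W - V|.
  have hbound : ∀ n : ℕ, P {ω | B (n + 1) (G (n + 1) ω)} ≤
      (2 * ((m : ENNReal) + 1) + 4) *
        (((n : ENNReal) + 1) * ENNReal.ofReal (Real.exp (-c * n))) := by
    intro n
    by_cases hn : N₀ ≤ n + 1
    swap
    · simp [B, hn]
    have hNpos : (0 : ℝ) < (n + 1 : ℕ) := by positivity
    have hNlt : max (4 / ρ) (1 / r) < (n + 1 : ℕ) := lt_of_lt_of_le hN₀ (by exact_mod_cast hn)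
    have hNρ : 1 / ((n + 1 : ℕ) : ℝ) < ρ / 4 := by
      have := lt_of_le_of_lt (le_max_left _ _) hNlt
      rw [div_lt_iff₀ hρ0] at this
      rw [div_lt_iff₀ hNpos]; linarith
    have hNr : 1 / ((n + 1 : ℕ) : ℝ) < r := by
      have := lt_of_le_of_lt (le_max_right _ _) hNlt
      rw [div_lt_iff₀ hr0] at this
      rw [div_lt_iff₀ hNpos]; linarith
    let bad₁ : ℕ → Set (Fin (n + 1) → I) := fun k => {u | (n + 1 : ℕ) * η <
      |((Finset.univ.filter fun j => (u j : ℝ) ≤ k / m).card : ℝ) - (n + 1 : ℕ) * (k / m)|}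
    let bad₂ : Set (Fin (n + 1) → I) := {u | 3 * δ * ((n : ℝ) + 1) ^ 2 <
      ∑ i, ∑ k : Fin n, |W.ker (u i) (u (i.succAbove k)) - V (u i, u (i.succAbove k))|}
    have hgood : ∀ u ∉ (⋃ k ∈ Finset.range (m + 1), bad₁ k) ∪ bad₂,
        ∑ g with B (n + 1) g, condProb W (u ∘ Tuple.sort u) g ≤
          2 * ((n + 1 : ℕ) * Real.exp (-κ * (n + 1 : ℕ))) := by
      intro u hu
      simp only [Set.mem_union, Set.mem_iUnion, not_or, not_exists, Finset.mem_range, bad₁, bad₂,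
        Set.mem_ofPred_eq, not_lt] at hu
      obtain ⟨hu₁, hu₂⟩ := hu
      refine le_trans (Finset.sum_le_sum_of_subset_of_nonneg ?_ fun g _ _ =>
        condProb_nonneg W _ g) (hκ W (n + 1) (u ∘ Tuple.sort u) _
          (abs_integral_mul_stepBasis_le hM))
      intro g hg
      simp only [Finset.mem_filter, Finset.mem_univ, true_and] at hg ⊢
      by_contra hcon
      push Not at hcon
      have hclose : ∀ s : I, s < 1 →
          dist ((u ∘ Tuple.sort u) (cell n.succ_pos s)) s < ρ := by
        intro s hs
        have h1 := abs_le.1 (abs_sort_sub_le hm0 u (η := η)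
          (fun k hk => hu₁ k (by omega)) (cell n.succ_pos s))
        have h2 := cell_div_le n.succ_pos hs
        rw [add_div] at h2
        rw [Subtype.dist_eq, Real.dist_eq, abs_lt]
        constructor <;> linarith [h1.1, h1.2, h2.1, h2.2]
      have hdet := integral_abs_fredholm_sub_le W n.succ_pos g (u ∘ Tuple.sort u) hVm hC
        f.continuous.aestronglyMeasurable hM (r := r) (S := 3 * δ) hcon
        (fun s t hs ht => by
          have := hρ (a := ((u ∘ Tuple.sort u) (cell n.succ_pos s),
            (u ∘ Tuple.sort u) (cell n.succ_pos t))) (b := (s, t))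
            (by rw [Prod.dist_eq]; exact max_lt (hclose s hs) (hclose t ht))
          rw [Real.dist_eq] at this
          exact this.le)
        (by
          rw [sum_comp_perm_offDiag u (Tuple.sort u) fun x y => |W.ker x y - V (x, y)|,
            sum_offDiag_eq_sum_succAbove u fun x y => |W.ker x y - V (x, y)|]
          push_cast
          exact hu₂) hVδ
      have hMδ : M * δ = ε / 16 := by rw [hδ]; field_simp
      have hMr : M * r = ε / 8 := by rw [hr]; field_simp
      have hMN : M * (1 / ((n + 1 : ℕ) : ℝ)) ≤ M * r := by gcongr
      have := hg.2
      have e : ε / 4 + M * (1 / ((n + 1 : ℕ) : ℝ) + 3 * δ + r + δ) =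
        ε / 4 + M * (1 / ((n + 1 : ℕ) : ℝ)) + 4 * (M * δ) + M * r := by ring
      linarith
    refine ((hG (n + 1)).measure_mem_le (B (n + 1)) _ hgood).trans ?_
    have hexp : ∀ a : ℝ, c ≤ a → ∀ k : ℕ, n ≤ k →
        ENNReal.ofReal (Real.exp (-a * k)) ≤ ENNReal.ofReal (Real.exp (-c * n)) := by
      intro a ha k hk
      refine ENNReal.ofReal_le_ofReal (Real.exp_le_exp.2 ?_)
      have : (n : ℝ) ≤ k := by exact_mod_cast hk
      have ha0 : 0 ≤ a := hc0.le.trans ha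
      have : c * n ≤ a * k := by gcongr
      linarith
    have hcκ : c ≤ κ := min_le_left _ _
    have hcη : c ≤ 2 * η ^ 2 := (min_le_right _ _).trans (min_le_left _ _)
    have hcδ : c ≤ 2 * δ ^ 2 / C ^ 2 := (min_le_right _ _).trans (min_le_right _ _)
    set E := ENNReal.ofReal (Real.exp (-c * n)) with hE
    have hEn : E ≤ ((n : ENNReal) + 1) * E := le_mul_of_one_le_left' le_add_self
    have t1 : ENNReal.ofReal (2 * ((n + 1 : ℕ) * Real.exp (-κ * (n + 1 : ℕ)))) ≤
        2 * (((n : ENNReal) + 1) * E) := by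
      rw [ENNReal.ofReal_mul (by norm_num), ENNReal.ofReal_mul (Nat.cast_nonneg _),
        ENNReal.ofReal_natCast, ENNReal.ofReal_ofNat]
      push_cast
      gcongr
      exact_mod_cast hexp κ hcκ (n + 1) n.le_succ
    have t2 : volume (⋃ k ∈ Finset.range (m + 1), bad₁ k) ≤
        2 * ((m : ENNReal) + 1) * (((n : ENNReal) + 1) * E) := by
      refine (measure_biUnion_finset_le _ _).trans ?_
      calc _ ≤ ∑ _k ∈ Finset.range (m + 1), 2 * (((n : ENNReal) + 1) * E) := by
            refine Finset.sum_le_sum fun k hk => ?_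
            refine (volume_abs_count_sub_gt_le (n + 1) ⟨by positivity, ?_⟩ hη0).trans ?_
            · rw [div_le_one hm0']
              exact_mod_cast Nat.lt_succ_iff.1 (Finset.mem_range.1 hk)
            · gcongr
              exact (hexp _ hcη (n + 1) n.le_succ).trans hEn
        _ = _ := by
            rw [Finset.sum_const, Finset.card_range, nsmul_eq_mul]
            push_cast
            ring
    have t3 : volume bad₂ ≤ 2 * (((n : ENNReal) + 1) * E) := by
      have hgm : Measurable (Function.uncurry fun x y => |W.ker x y - V (x, y)|) :=
        (W.measurable_ker.sub hVm).abs
      refine (measure_pi_offDiag_sum_gt_le (volume : Measure I) hgm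
        (fun x y => ⟨abs_nonneg _, hC x y⟩) hδ0 hVδ n).trans ?_
      rw [two_mul (((n : ENNReal) + 1) * E)]
      refine add_le_add ?_ ((hexp _ hcδ (n + 1) n.le_succ).trans hEn)
      gcongr
      exact hexp _ hcδ n le_rfl
    refine (add_le_add t1 ((measure_union_le _ _).trans (add_le_add t2 t3))).trans (le_of_eq ?_)
    ring
  have hBC : ∀ᵐ ω ∂P, ∀ᶠ n in atTop, ¬ B (n + 1) (G (n + 1) ω) := by
    refine ae_eventually_notMem (s := fun n => {ω | B (n + 1) (G (n + 1) ω)})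
      (ne_top_of_le_ne_top ?_ (ENNReal.tsum_le_tsum hbound))
    rw [ENNReal.tsum_mul_left]
    refine ENNReal.mul_ne_top ?_ (tsum_succ_mul_ofReal_exp_ne_top hc0)
    finiteness
  filter_upwards [hBC] with ω hω
  have h1 : ∀ᶠ N in atTop, ¬ B N (G N ω) := by
    obtain ⟨a, ha⟩ := eventually_atTop.1 hω
    refine eventually_atTop.2 ⟨a + 1, fun N hN => ?_⟩
    obtain ⟨n, rfl⟩ : ∃ n, N = n + 1 := ⟨N - 1, by omega⟩
    exact ha n (by omega)
  filter_upwards [h1, eventually_ge_atTop N₀] with N hN hN'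
  by_contra hcon
  exact hN ⟨hN', not_le.1 hcon⟩

end AlmostSure

/-! ### Strong convergence of contractions and of polynomial filters. -/

section Operators

lemma fredholm_sub {w : I → I → ℝ} (hw : Measurable (Function.uncurry w))
    (hb : ∀ x y, w x y ∈ Set.Icc (0 : ℝ) 1) {f g : I → ℝ} (hf : Integrable f volume)
    (hg : Integrable g volume) : fredholm w (f - g) = fredholm w f - fredholm w g := by
  ext s
  have hi : ∀ {h : I → ℝ}, Integrable h volume → Integrable (fun t => w s t * h t) volume :=
    fun hh => hh.bdd_mul (c := 1) (hw.comp measurable_prodMk_left).aestronglyMeasurable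
      (Eventually.of_forall fun t => by
        rw [Real.norm_of_nonneg (hb s t).1]
        exact (hb s t).2)
  simp only [fredholm, Pi.sub_apply, mul_sub]
  exact integral_sub (hi hf) (hi hg)

lemma norm_fredholm_le {w : I → I → ℝ} (hb : ∀ x y, w x y ∈ Set.Icc (0 : ℝ) 1) {f : I → ℝ}
    (hf : Integrable f volume) (s : I) : ‖fredholm w f s‖ ≤ ∫ t, ‖f t‖ := by
  refine norm_integral_le_of_norm_le hf.norm (Eventually.of_forall fun t => ?_)
  rw [norm_mul, Real.norm_of_nonneg (hb s t).1]
  exact mul_le_of_le_one_left (norm_nonneg _) (hb s t).2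

/-- The Fredholm operator of a kernel with values in `[0,1]` is a contraction. -/
lemma eLpNorm_fredholm_le {w : I → I → ℝ} (hb : ∀ x y, w x y ∈ Set.Icc (0 : ℝ) 1) {f : I → ℝ}
    (hf : MemLp f 2 volume) : eLpNorm (fredholm w f) 2 volume ≤ eLpNorm f 2 volume := by
  have hi : Integrable f volume := hf.integrable (by norm_num)
  calc eLpNorm (fredholm w f) 2 volume
      ≤ volume (Set.univ : Set I) ^ (ENNReal.toReal 2)⁻¹ * ENNReal.ofReal (∫ t, ‖f t‖) :=
        eLpNorm_le_of_ae_bound (Eventually.of_forall (norm_fredholm_le hb hi))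
    _ = eLpNorm f 1 volume := by
        rw [measure_univ, ENNReal.one_rpow, one_mul, eLpNorm_one_eq_lintegral_enorm,
          ofReal_integral_norm_eq_lintegral_enorm hi]
    _ ≤ eLpNorm f 2 volume := eLpNorm_le_eLpNorm_of_exponent_le (by norm_num) hf.1

lemma lift_mem_Icc {N : ℕ} {x : Fin N → ℝ} (hx : ∀ i, x i ∈ Set.Icc (0 : ℝ) 1) (t : I) :
    lift x t ∈ Set.Icc (0 : ℝ) 1 := by
  simp only [lift, stepBasis_eq_ite]
  by_cases h : ⌊(N : ℝ) * t⌋₊ < N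
  · rw [Finset.sum_eq_single ⟨_, h⟩]
    · simpa using hx _
    · intro i _ hi
      rw [if_neg fun h' => hi (Fin.ext h'.symm), mul_zero]
    · simp
  · rw [Finset.sum_eq_zero]
    · simp
    · intro i _
      rw [if_neg fun h' : _ = (i : ℕ) => h (h'.trans_lt i.2), mul_zero]

lemma empirical_eq_lift {N : ℕ} (G : SimpleGraph (Fin N)) (s t : I) :
    empirical G s t = lift (fun i => lift (adjacency G i) t) s := by
  simp only [empirical, lift, Finset.sum_mul]
  exact Finset.sum_congr rfl fun i _ => Finset.sum_congr rfl fun j _ => by ring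

lemma empirical_mem_Icc {N : ℕ} (G : SimpleGraph (Fin N)) (s t : I) :
    empirical G s t ∈ Set.Icc (0 : ℝ) 1 := by
  rw [empirical_eq_lift]
  exact lift_mem_Icc (fun i => lift_mem_Icc (adjacency_mem_Icc G i) t) s

lemma measurable_empirical {N : ℕ} (G : SimpleGraph (Fin N)) :
    Measurable (Function.uncurry (empirical G)) := by
  unfold empirical Function.uncurry
  exact Finset.measurable_sum _ fun i _ => Finset.measurable_sum _ fun j _ =>
    (((measurable_stepBasis N i).comp measurable_fst).const_mul _).mul
      ((measurable_stepBasis N j).comp measurable_snd)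

/-- For uniformly bounded functions, ∫ h² ≤ K ∫ |h|. -/
lemma tendsto_eLpNorm_two_of_tendsto_integral_abs {h : ℕ → I → ℝ}
    (hm : ∀ N, MemLp (h N) 2 volume) {K : ℝ} (hK : ∀ N t, |h N t| ≤ K)
    (hlim : Tendsto (fun N => ∫ t, |h N t|) atTop (𝓝 0)) :
    Tendsto (fun N => eLpNorm (h N) 2 volume) atTop (𝓝 0) := by
  have hsq : Tendsto (fun N => ∫ t, ‖h N t‖ ^ (2 : ℝ)) atTop (𝓝 0) := by
    have hKlim : Tendsto (fun N => K * ∫ t, |h N t|) atTop (𝓝 0) := by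
      simpa using hlim.const_mul K
    refine squeeze_zero (fun N => integral_nonneg fun t => by positivity) (fun N => ?_) hKlim
    rw [← integral_const_mul]
    refine integral_mono_of_nonneg (Eventually.of_forall fun t => by positivity)
      ((((hm N).integrable (by norm_num)).abs).const_mul K) (Eventually.of_forall fun t => ?_)
    simp only [Real.rpow_two, Real.norm_eq_abs, sq]
    exact mul_le_mul_of_nonneg_right (hK N t) (abs_nonneg _)
  have heq : ∀ N, eLpNorm (h N) 2 volume =
      ENNReal.ofReal ((∫ t, ‖h N t‖ ^ (2 : ℝ)) ^ (2⁻¹ : ℝ)) := fun N => by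
    rw [(hm N).eLpNorm_eq_integral_rpow_norm (by norm_num) (by norm_num)]
    simp
  simp only [heq]
  have hr := hsq.rpow_const (p := (2⁻¹ : ℝ)) (Or.inr (by norm_num))
  rw [Real.zero_rpow (by norm_num)] at hr
  simpa using ENNReal.tendsto_ofReal hr

/-- Strong convergence of contractions passes to a limit from convergence on the continuous
functions of a dense sequence. -/
lemma tendsto_fredholm_of_denseSeq {w : ℕ → I → I → ℝ} {v : I → I → ℝ}
    (hw : ∀ N, Measurable (Function.uncurry (w N))) (hwb : ∀ N x y, w N x y ∈ Set.Icc (0 : ℝ) 1)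
    (hv : Measurable (Function.uncurry v)) (hvb : ∀ x y, v x y ∈ Set.Icc (0 : ℝ) 1)
    (hd : ∀ k, Tendsto (fun N => eLpNorm (fredholm (w N) (TopologicalSpace.denseSeq C(I, ℝ) k) -
      fredholm v (TopologicalSpace.denseSeq C(I, ℝ) k)) 2 volume) atTop (𝓝 0))
    {f : I → ℝ} (hf : MemLp f 2 volume) :
    Tendsto (fun N => eLpNorm (fredholm (w N) f - fredholm v f) 2 volume) atTop (𝓝 0) := by
  rw [ENNReal.tendsto_nhds_zero]
  intro ε hε
  by_cases hεtop : ε = ⊤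
  · exact Eventually.of_forall fun N => hεtop ▸ le_top
  -- Passing from f to a continuous g and on to the dense sequence costs 2η, under each of the two
  -- contractions; the convergence on the dense sequence costs one more η.
  have hη : ε / 5 ≠ 0 := (ENNReal.div_pos hε.ne' (by norm_num)).ne'
  have hηtop : ε / 5 ≠ ⊤ := ENNReal.div_ne_top hεtop (by norm_num)
  set η := ε / 5 with hηdef
  obtain ⟨g, hg, hgm⟩ := hf.exists_boundedContinuous_eLpNorm_sub_le (by norm_num) hη
  obtain ⟨k, hk⟩ := (TopologicalSpace.denseRange_denseSeq C(I, ℝ)).exists_dist_lt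
    g.toContinuousMap (ENNReal.toReal_pos hη hηtop)
  set q := TopologicalSpace.denseSeq C(I, ℝ) k with hq
  have hqm : MemLp q 2 volume := MemLp.of_bound q.continuous.aestronglyMeasurable ‖q‖
    (Eventually.of_forall q.norm_coe_le_norm)
  have hgq : eLpNorm ((g : I → ℝ) - (q : I → ℝ)) 2 volume ≤ η := by
    refine (eLpNorm_le_of_ae_bound (C := η.toReal) (Eventually.of_forall fun t => ?_)).trans ?_
    · rw [Pi.sub_apply, ← dist_eq_norm]
      exact (ContinuousMap.dist_apply_le_dist (f := g.toContinuousMap) (g := q) t).trans hk.le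
    · rw [measure_univ, ENNReal.one_rpow, one_mul, ENNReal.ofReal_toReal hηtop]
  have hfq : eLpNorm (f - (q : I → ℝ)) 2 volume ≤ 2 * η := by
    have : f - (q : I → ℝ) = (f - g) + ((g : I → ℝ) - (q : I → ℝ)) := by simp
    rw [this, two_mul]
    exact (eLpNorm_add_le (hf.sub hgm).1 (hgm.sub hqm).1 (by norm_num)).trans (add_le_add hg hgq)
  have h12 : (1 : ENNReal) ≤ 2 := by norm_num
  have hfi := hf.integrable h12
  have hqi := hqm.integrable h12
  filter_upwards [ENNReal.tendsto_nhds_zero.1 (hd k) η (pos_iff_ne_zero.2 hη)] with N hN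
  have hdec : fredholm (w N) f - fredholm v f = fredholm (w N) (f - (q : I → ℝ)) +
      (fredholm (w N) q - fredholm v q) - fredholm v (f - (q : I → ℝ)) := by
    rw [fredholm_sub (hw N) (hwb N) hfi hqi, fredholm_sub hv hvb hfi hqi]
    abel
  have m1 := memLp_fredholm (hw N) (hwb N) (hf.sub hqm)
  have m2 := (memLp_fredholm (hw N) (hwb N) hqm).sub (memLp_fredholm hv hvb hqm)
  have m3 := memLp_fredholm hv hvb (hf.sub hqm)
  rw [hdec]
  calc _ ≤ eLpNorm (fredholm (w N) (f - (q : I → ℝ))) 2 volume +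
        eLpNorm (fredholm (w N) q - fredholm v q) 2 volume +
        eLpNorm (fredholm v (f - (q : I → ℝ))) 2 volume :=
        (eLpNorm_sub_le (m1.add m2).1 m3.1 h12).trans
          (add_le_add (eLpNorm_add_le m1.1 m2.1 h12) le_rfl)
    _ ≤ 2 * η + η + 2 * η := add_le_add (add_le_add
        ((eLpNorm_fredholm_le (hwb N) (hf.sub hqm)).trans hfq) hN)
        ((eLpNorm_fredholm_le hvb (hf.sub hqm)).trans hfq)
    _ = 5 * η := by ring
    _ = ε := by rw [hηdef]; exact ENNReal.mul_div_cancel (by norm_num) (by norm_num)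

lemma memLp_iterate_fredholm {w : I → I → ℝ} (hw : Measurable (Function.uncurry w))
    (hb : ∀ x y, w x y ∈ Set.Icc (0 : ℝ) 1) {f : I → ℝ} (hf : MemLp f 2 volume) (k : ℕ) :
    MemLp ((fredholm w)^[k] f) 2 volume := by
  induction k with
  | zero => exact hf
  | succ k ih => rw [Function.iterate_succ_apply']; exact memLp_fredholm hw hb ih

section Convergence

variable {w : ℕ → I → I → ℝ} {v : I → I → ℝ}
  (hw : ∀ N, Measurable (Function.uncurry (w N))) (hwb : ∀ N x y, w N x y ∈ Set.Icc (0 : ℝ) 1)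
  (hv : Measurable (Function.uncurry v)) (hvb : ∀ x y, v x y ∈ Set.Icc (0 : ℝ) 1)
  (hlim : ∀ f : I → ℝ, MemLp f 2 volume →
    Tendsto (fun N => eLpNorm (fredholm (w N) f - fredholm v f) 2 volume) atTop (𝓝 0))
  {y : ℕ → I → ℝ} {f : I → ℝ} (hy : ∀ N, MemLp (y N) 2 volume) (hf : MemLp f 2 volume)
  (hyf : Tendsto (fun N => eLpNorm (y N - f) 2 volume) atTop (𝓝 0))

include hw hwb hv hvb hlim hy hf hyf

lemma tendsto_iterate_fredholm (k : ℕ) :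
    Tendsto (fun N => eLpNorm ((fredholm (w N))^[k] (y N) - (fredholm v)^[k] f) 2 volume)
      atTop (𝓝 0) := by
  induction k with
  | zero => exact hyf
  | succ k ih =>
    have hfk := memLp_iterate_fredholm hv hvb hf k
    have hsum := ih.add (hlim _ hfk)
    rw [add_zero] at hsum
    refine tendsto_of_tendsto_of_tendsto_of_le_of_le tendsto_const_nhds hsum
      (fun N => zero_le) fun N => ?_
    have hyk := memLp_iterate_fredholm (hw N) (hwb N) (hy N) k
    simp only [Function.iterate_succ_apply']
    set a := (fredholm (w N))^[k] (y N)
    set b := (fredholm v)^[k] f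
    -- The first term is at most the previous error by contractivity. In the second the input b no
    -- longer depends on N, so strong convergence suffices.
    have hdec : fredholm (w N) a - fredholm v b =
        fredholm (w N) (a - b) + (fredholm (w N) b - fredholm v b) := by
      rw [fredholm_sub (hw N) (hwb N) (hyk.integrable (by norm_num)) (hfk.integrable (by norm_num))]
      abel
    rw [hdec]
    exact (eLpNorm_add_le (memLp_fredholm (hw N) (hwb N) (hyk.sub hfk)).1
      ((memLp_fredholm (hw N) (hwb N) hfk).sub (memLp_fredholm hv hvb hfk)).1 (by norm_num)).trans
      (add_le_add (eLpNorm_fredholm_le (hwb N) (hyk.sub hfk)) le_rfl)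

/-- Polynomial filters of strongly convergent contractions converge. -/
lemma tendsto_operatorFilter (K : ℕ) (h : ℕ → ℝ) :
    Tendsto (fun N => eLpNorm (operatorFilter K h (w N) (y N) - operatorFilter K h v f) 2 volume)
      atTop (𝓝 0) := by
  have hit := tendsto_iterate_fredholm hw hwb hv hvb hlim hy hf hyf
  have hbound : Tendsto (fun N => ENNReal.ofReal |h 0| * eLpNorm (y N - f) 2 volume +
      ∑ k ∈ Finset.Icc 1 K, ENNReal.ofReal |h k| *
        eLpNorm ((fredholm (w N))^[k] (y N) - (fredholm v)^[k] f) 2 volume) atTop (𝓝 0) := by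
    have hc : ∀ (c : ℝ) {u : ℕ → ENNReal}, Tendsto u atTop (𝓝 0) →
        Tendsto (fun N => ENNReal.ofReal |c| * u N) atTop (𝓝 0) := fun c u hu => by
      simpa using ENNReal.Tendsto.const_mul hu (Or.inr ENNReal.ofReal_ne_top)
    simpa using (hc (h 0) hyf).add
      (tendsto_finsetSum (Finset.Icc 1 K) fun k _ => hc (h k) (hit k))
  refine tendsto_of_tendsto_of_tendsto_of_le_of_le tendsto_const_nhds hbound
    (fun N => zero_le) fun N => ?_
  have hm : ∀ k, MemLp ((fredholm (w N))^[k] (y N) - (fredholm v)^[k] f) 2 volume := fun k =>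
    (memLp_iterate_fredholm (hw N) (hwb N) (hy N) k).sub (memLp_iterate_fredholm hv hvb hf k)
  have hdec : operatorFilter K h (w N) (y N) - operatorFilter K h v f =
      h 0 • (y N - f) + ∑ k ∈ Finset.Icc 1 K,
        h k • ((fredholm (w N))^[k] (y N) - (fredholm v)^[k] f) := by
    ext t
    simp only [operatorFilter, Pi.sub_apply, Pi.add_apply, Pi.smul_apply, smul_eq_mul,
      Finset.sum_apply, mul_sub, Finset.sum_sub_distrib]
    ring
  have hs : ∀ (c : ℝ) (u : I → ℝ), eLpNorm (c • u) 2 volume =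
      ENNReal.ofReal |c| * eLpNorm u 2 volume := fun c u => by
    rw [eLpNorm_const_smul, Real.enorm_eq_ofReal_abs]
  simp only [hdec]
  refine (eLpNorm_add_le (((hy N).sub hf).const_smul _).1
    (memLp_finsetSum' _ fun k _ => (hm k).const_smul (h k)).1 (by norm_num)).trans
    (add_le_add (hs _ _).le ?_)
  refine (eLpNorm_sum_le (fun k _ => ((hm k).const_smul (h k)).1) (by norm_num)).trans
    (le_of_eq (Finset.sum_congr rfl fun k _ => hs _ _))

end Convergence

/-- The lifts of the strip means or of samples of a continuous function converge to it. -/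
lemma tendsto_lift_of_continuous {f : I → ℝ} (hf : Continuous f) {x : (N : ℕ) → Fin N → ℝ}
    (hx : ∀ N i, x N i = stripMean f N i ∨ x N i ∈ stripValues f N i) :
    Tendsto (fun N => eLpNorm (lift (x N) - f) 2 volume) atTop (𝓝 0) := by
  rw [ENNReal.tendsto_nhds_zero]
  intro ε hε
  by_cases hεtop : ε = ⊤
  · exact Eventually.of_forall fun N => hεtop ▸ le_top
  have hη : 0 < ε.toReal := ENNReal.toReal_pos hε.ne' hεtop
  set η := ε.toReal with hηdef
  obtain ⟨ρ, hρ0, hρ⟩ := Metric.uniformContinuous_iff.1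
    (CompactSpace.uniformContinuous_of_continuous hf) η hη
  obtain ⟨N₀, hN₀⟩ := exists_nat_gt (1 / ρ)
  have hfi : Integrable f volume :=
    hf.integrable_of_hasCompactSupport (HasCompactSupport.of_compactSpace f)
  filter_upwards [eventually_ge_atTop N₀] with N hN
  have hN1 : 1 / ρ < (N : ℝ) := hN₀.trans_le (by exact_mod_cast hN)
  have hN0' : (0 : ℝ) < N := lt_trans (by positivity) hN1
  have hN0 : 0 < N := by exact_mod_cast hN0'
  have hNρ : 1 / (N : ℝ) < ρ := by
    rw [div_lt_iff₀ hρ0] at hN1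
    rw [div_lt_iff₀ hN0']; linarith
  refine (eLpNorm_le_of_ae_bound (C := η) ?_).trans ?_
  · filter_upwards [ae_lt_one] with t ht
    rw [Pi.sub_apply, lift_eq_cell hN0 _ ht]
    set i := cell hN0 t
    have hti : (i : ℝ) / N ≤ t ∧ (t : ℝ) < ((i : ℝ) + 1) / N := cell_div_le hN0 ht
    -- The closed strip still has diameter at most 1/N < ρ, so this one estimate serves both samples
    -- and means.
    have hclose : ∀ s : I, (i : ℝ) / N ≤ s → (s : ℝ) ≤ ((i : ℝ) + 1) / N → ‖f s - f t‖ ≤ η := by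
      intro s h1 h2
      rw [← dist_eq_norm]
      refine (hρ ?_).le
      rw [add_div] at h2 hti
      rw [Subtype.dist_eq, Real.dist_eq, abs_lt]
      constructor <;> linarith [hti.1, hti.2]
    rcases hx N i with h | ⟨s, hs, h⟩
    · have e : stripMean f N i - f t = N * ∫ s, (f s - f t) * stepBasis N i s := by
        have hint : Integrable (fun s => f s * stepBasis N i s) volume :=
          hfi.mul_bdd (c := 1) (measurable_stepBasis N i).aestronglyMeasurable
            (Eventually.of_forall fun t => by
              have h := stepBasis_mem_Icc i t
              rw [Real.norm_of_nonneg h.1]; exact h.2)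
        simp only [sub_mul, stripMean]
        rw [integral_sub hint ((integrable_stepBasis N i).const_mul _), integral_const_mul,
          integral_stepBasis]
        field_simp
      have e2 : ‖∫ s, (f s - f t) * stepBasis N i s‖ ≤ ∫ s, η * stepBasis N i s := by
        refine norm_integral_le_of_norm_le ((integrable_stepBasis N i).const_mul η)
          (Eventually.of_forall fun s => ?_)
        by_cases hs : (i : ℝ) / N ≤ s ∧ (s : ℝ) < ((i : ℝ) + 1) / N
        · have h0 := (stepBasis_mem_Icc i s).1
          rw [norm_mul, Real.norm_of_nonneg h0]
          exact mul_le_mul_of_nonneg_right (hclose s hs.1 hs.2.le) h0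
        · have : stepBasis N i s = 0 := by
            rw [stepBasis_eq_ite, if_neg fun h' => hs ((mem_strip_iff_floor i s).2 h')]
          simp [this]
      rw [h, e, norm_mul, Real.norm_of_nonneg hN0'.le]
      rw [integral_const_mul, integral_stepBasis] at e2
      calc (N : ℝ) * ‖∫ s, (f s - f t) * stepBasis N i s‖ ≤ N * (η * (1 / N)) := by gcongr
        _ = η := by field_simp
    · rw [← h]
      exact hclose s hs.1 hs.2
  · rw [measure_univ, ENNReal.one_rpow, one_mul, hηdef, ENNReal.ofReal_toReal hεtop]

/-- Almost surely, the empirical operators converge strongly to the operator of the graphon. -/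
theorem ae_tendsto_fredholm_empirical {Ω : Type*} [MeasurableSpace Ω] (P : Measure Ω)
    (W : Graphon) (G : (N : ℕ) → Ω → SimpleGraph (Fin N))
    (hG : ∀ N, IsSampledGraph P W N (G N)) :
    ∀ᵐ ω ∂P, ∀ f : I → ℝ, MemLp f 2 volume →
      Tendsto (fun N => eLpNorm (fredholm (empirical (G N ω)) f - fredholm W.ker f) 2 volume)
        atTop (𝓝 0) := by
  -- Only countably many functions and tolerances occur, so a single null set serves every f, and
  -- hence all filters and inputs.
  have hae : ∀ᵐ ω ∂P, ∀ k n : ℕ, ∀ᶠ N in atTop,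
      ∫ s, |fredholm (empirical (G N ω)) (TopologicalSpace.denseSeq C(I, ℝ) k) s -
        fredholm W.ker (TopologicalSpace.denseSeq C(I, ℝ) k) s| ≤ 1 / ((n : ℝ) + 1) :=
    ae_all_iff.2 fun k => ae_all_iff.2 fun n =>
      ae_eventually_integral_abs_fredholm_sub_le P W G hG _ (by positivity)
  filter_upwards [hae] with ω hω f hf
  refine tendsto_fredholm_of_denseSeq (fun N => measurable_empirical _)
    (fun N => empirical_mem_Icc _) W.measurable_ker W.mem_Icc (fun k => ?_) hf
  set q := TopologicalSpace.denseSeq C(I, ℝ) k with hq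
  have hqm : MemLp q 2 volume := MemLp.of_bound q.continuous.aestronglyMeasurable ‖q‖
    (Eventually.of_forall q.norm_coe_le_norm)
  have hqi : Integrable q volume := hqm.integrable (by norm_num)
  refine tendsto_eLpNorm_two_of_tendsto_integral_abs
    (fun N => (memLp_fredholm (measurable_empirical _) (empirical_mem_Icc _) hqm).sub
      (memLp_fredholm W.measurable_ker W.mem_Icc hqm))
    (K := (∫ t, ‖q t‖) + ∫ t, ‖q t‖)
    (fun N s => (abs_sub _ _).trans (add_le_add (norm_fredholm_le (empirical_mem_Icc _) hqi s)
      (norm_fredholm_le W.mem_Icc hqi s))) ?_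
  rw [Metric.tendsto_atTop']
  intro ε hε
  obtain ⟨n, hn⟩ := exists_nat_one_div_lt hε
  obtain ⟨a, ha⟩ := eventually_atTop.1 (hω k n)
  refine ⟨a, fun N hN => ?_⟩
  rw [Real.dist_0_eq_abs, abs_of_nonneg (integral_nonneg fun s => abs_nonneg _)]
  exact (ha N hN.le).trans_lt hn

end Operators

end GraphonFilter

/-! ### The main theorem. -/

theorem theorem3 {Ω : Type*} [MeasurableSpace Ω] (P : Measure Ω) [IsProbabilityMeasure P]
    (W : Graphon) (G : (N : ℕ) → Ω → SimpleGraph (Fin N))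
    (hG : ∀ N, IsSampledGraph P W N (G N)) :
    -- the lifted output of the graph filter is the output of the empirical graphon filter
    (∀ (ω : Ω) (K : ℕ) (h : ℕ → ℝ) (N : ℕ) (x : Fin N → ℝ),
      lift ((graphFilter K h (G N ω)).mulVec x) =
        operatorFilter K h (empirical (G N ω)) (lift x)) ∧
    ∀ᵐ ω ∂P, ∀ (K : ℕ) (h : ℕ → ℝ) (f : I → ℝ) (x : (N : ℕ) → Fin N → ℝ),
      -- a continuous input, with means or samples over the strips as the graph signal
      (Continuous f →
        (∀ N i, x N i = stripMean f N i ∨ x N i ∈ stripValues f N i) →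
        Tendsto (fun N => eLpNorm (lift ((graphFilter K h (G N ω)).mulVec (x N)) -
          operatorFilter K h W.ker f) 2 volume) atTop (𝓝 0)) ∧
      -- a square integrable input, with graph signals whose lifts approximate it
      (MemLp f 2 volume →
        Tendsto (fun N => eLpNorm (lift (x N) - f) 2 volume) atTop (𝓝 0) →
        Tendsto (fun N => eLpNorm (lift ((graphFilter K h (G N ω)).mulVec (x N)) -
          operatorFilter K h W.ker f) 2 volume) atTop (𝓝 0)) := by
  refine ⟨fun ω K h N x => lift_graphFilter_mulVec K h (G N ω) x, ?_⟩
  filter_upwards [ae_tendsto_fredholm_empirical P W G hG] with ω hω K h f x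
  -- The continuous case is an instance of the L² case, since the lifts of means or samples
  -- converge.
  have key : MemLp f 2 volume →
      Tendsto (fun N => eLpNorm (lift (x N) - f) 2 volume) atTop (𝓝 0) →
      Tendsto (fun N => eLpNorm (lift ((graphFilter K h (G N ω)).mulVec (x N)) -
        operatorFilter K h W.ker f) 2 volume) atTop (𝓝 0) := by
    intro hf hxf
    simp only [lift_graphFilter_mulVec]
    exact tendsto_operatorFilter (fun N => measurable_empirical _) (fun N => empirical_mem_Icc _)
      W.measurable_ker W.mem_Icc hω (fun N => memLp_lift (x N)) hf hxf K h
  refine ⟨fun hf hx => key ?_ (tendsto_lift_of_continuous hf hx), key⟩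
  exact hf.memLp_of_hasCompactSupport (HasCompactSupport.of_compactSpace f)
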